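/- **Theorem 1 (Regret bound for Successive Expert Elimination, SEE).** *Setting.* There are $N$ experts $\mathcal E=\{1,\dots,N\}$ and contexts drawn i.i.d. from a law $P$. In round $t$ with context $x_t$, expert $i$ receives a binary score $s_i(x_t)\in\{0,1\}$ ($1$ = correct). Its competency is $p_i=\mathbb E_{x\sim P}[s_i(x)]$, and each $s_i-p_i$ is sub-Gaussian with variance proxy $\sigma^2$ (for binary scores $\sigma=1/2$ is always admissible). For a vector $r=(r_i)$ and a non-empty $C\subseteq\mathcal E$ the egalitarian majority-vote accuracy is $$P_{\mathrm{maj}}(r;C)=\sum_{S\subseteq C,\ |S|>|C|/2}\ \prod_{i\in S}r_i\prod_{j\in C\setminus S}(1-r_j)+\tfrac12\sum_{S\subseteq C,\ |S|=|C|/2}\ \prod_{i\in S}r_i\prod_{j\in C\setminus S}(1-r_j),$$ and $P_{\mathrm{maj}}(r;\emptyset)=0$ (for independent experts, $P_{\mathrm{maj}}(p;C)$ is the accuracy of the committee $C$ under majority vote with random tie-breaking). The advantage function is $A(r;E_1,E_2)=P_{\mathrm{maj}}(r;E_1\cup E_2)-P_{\mathrm{maj}}(r;E_1)$. For estimates $q$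 with confidence half-width $b$ and disjoint $E_1,E_2$, the conservative advantage $\underline{A}(q,b;E_1,E_2)$ is $A(r;E_1,E_2)$ with $r_i=q_i-b$ on $E_1$ and $r_j=q_j+b$ on $E_2$. There is a breakage between $i$ and $j$ if $q_j+b<q_i-b$. Let $\mathcal E^*$ maximize $P_{\mathrm{maj}}(p;\cdot)$ over all subsets of $\mathcal E$. *Algorithm (SEE with horizon $T$ and $\delta=1/T$).* Start with $C_0=\mathcal E$. In round $t=1,\dots,T$ play $C_{t-1}$, and for its members compute the empirical competencies $\hat p_i^t$ from the $t$ samples seen so far, with half-width $b_t=\sqrt{2\sigma^2\log(4/\delta)/t}$. Set $C=C_{t-1}$ and go through its experts $j$ in descending order of $\hat p^t$, skipping those already removed. Put $C^{\le j}=\{k\in C:\hat p_k^t\le\hat p_j^t\}$ and $C^{>j}=C\setminus C^{\le j}$. If $C^{>j}\ne\emptyset$, every $i\in C^{>j}$ is in breakage with $j$, and $\underline{A}(\hat p^t,b_t;C^{>j},E')\le0$ for every set $E'$ consisting of the best $m$ members of $C^{\le j}$ by $\hat p^t$ ($1\le m\le|C^{\le j}|$), replace $C$ by $C^{>j}$.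 The result is $C_t$. *Gaps.* Let $\varepsilon>0$ satisfy $|p_i-p_j|\ge\varepsilon$ for all $i\ne j$. Let $\varepsilon_{\mathrm{maj}}\in[0,1]$ be the consistency gap: the largest $g\in[0,1]$ such that, for all disjoint non-empty $E_1,E_2\subseteq\mathcal E$ for which both $E_1$ and $E_1\cup E_2$ consist of the most competent experts (each member has strictly larger competency than each non-member), and for all $(q,b)$ with $2b<g$, $|q_i-p_i|\le b$ for all $i$, and a breakage between every $i\in E_1$ and $j\in E_2$, one has $\underline{A}(q,b;E_1,E_2)>0\iff A(p;E_1,E_2)>0$. Assume $\varepsilon_{\mathrm{maj}}>0$. *Conclusion.* There is a universal constant $K>0$ such that, for all $T\ge2$ and all such data, the expected cumulative regret $R_T=\mathbb E\Big[\sum_{t=1}^{T}\big(P_{\mathrm{maj}}(p;\mathcal E^*)-P_{\mathrm{maj}}(p;C_{t-1})\big)\Big]$ satisfies $$R_T\ \le\ K\,\frac{N\,(\sigma^2+1)\,\log T}{\min\{\varepsilon,\varepsilon_{\mathrm{maj}}\}^2}.$$ In particular, for fixed $\sigma$, $R_T=O\big(N\log T/\min\{\varepsilon,\varepsilon_{\mathrm{maj}}\}^2\big)$.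 -/

import Mathlib

open MeasureTheory ProbabilityTheory
open scoped NNReal

noncomputable section

namespace SEE

variable {N : ℕ}

/-! ### Egalitarian majority voting -/

/-- Accuracy of the egalitarian committee `C` when its members are independently correct with
probabilities `p i`: a strict majority of correct votes wins, a tie is broken by a fair coin, and
the empty committee has accuracy `0` by convention. -/
def pMaj (p : Fin N → ℝ) (C : Finset (Fin N)) : ℝ :=
  if C = ∅ then 0
  else
    (∑ S ∈ C.powerset with C.card < 2 * S.card, (∏ i ∈ S, p i) * ∏ j ∈ C \ S, (1 - p j))
      + 1 / 2 *
        ∑ S ∈ C.powerset with 2 * S.card = C.card, (∏ i ∈ S, p i) * ∏ j ∈ C \ S, (1 - p j)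

/-- The advantage of adding the experts `E₂` to the committee `E₁`. -/
def advantage (p : Fin N → ℝ) (E₁ E₂ : Finset (Fin N)) : ℝ :=
  pMaj p (E₁ ∪ E₂) - pMaj p E₁

/-- `E` is an optimal egalitarian committee. -/
def IsOptimalCommittee (p : Fin N → ℝ) (E : Finset (Fin N)) : Prop :=
  ∀ E' : Finset (Fin N), pMaj p E' ≤ pMaj p E

/-! ### Confidence intervals, breakage, conservative advantage

Below, `q` is a vector of estimated competencies and `b` the confidence half-width. -/

/-- Breakage: the upper confidence limit of `j` lies below the lower confidence limit of `i`. -/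
def Breakage (q : Fin N → ℝ) (b : ℝ) (i j : Fin N) : Prop :=
  q j + b < q i - b

/-- Optimistic estimates on `E₂`, pessimistic estimates elsewhere. -/
def conservative (q : Fin N → ℝ) (b : ℝ) (E₂ : Finset (Fin N)) (i : Fin N) : ℝ :=
  if i ∈ E₂ then q i + b else q i - b

/-- The conservative advantage of `E₂` over `E₁` (used for disjoint sets): pessimistic estimates
for `E₁`, optimistic ones for `E₂`. -/
def conservativeAdvantage (q : Fin N → ℝ) (b : ℝ) (E₁ E₂ : Finset (Fin N)) : ℝ :=
  advantage (conservative q b E₂) E₁ E₂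

/-! ### The consistency gap -/

/-- `E₁` consists of the most competent experts, and `E₂` of the next most competent ones. -/
structure IsTopPair (p : Fin N → ℝ) (E₁ E₂ : Finset (Fin N)) : Prop where
  nonempty_left : E₁.Nonempty
  nonempty_right : E₂.Nonempty
  disjoint : Disjoint E₁ E₂
  top_left : ∀ i ∈ E₁, ∀ j ∉ E₁, p j < p i
  top_union : ∀ i ∈ E₁ ∪ E₂, ∀ j ∉ E₁ ∪ E₂, p j < p i

/-- Consistent inclusion at level `g`: whenever the confidence intervals `q i ± b` contain the true
competencies, `2 b < g`, and `E₁`, `E₂` are separated by a breakage, the conservative advantage of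
`E₂` over `E₁` is positive exactly if the true advantage is. -/
def ConsistentInclusion (p : Fin N → ℝ) (g : ℝ) : Prop :=
  ∀ E₁ E₂ : Finset (Fin N), IsTopPair p E₁ E₂ →
    ∀ (q : Fin N → ℝ) (b : ℝ), 2 * b < g → (∀ i, |q i - p i| ≤ b) →
      (∀ i ∈ E₁, ∀ j ∈ E₂, Breakage q b i j) →
      (0 < conservativeAdvantage q b E₁ E₂ ↔ 0 < advantage p E₁ E₂)

/-- The consistency gap: the largest level in `[0, 1]` at which inclusion is consistent. -/
def consistencyGap (p : Fin N → ℝ) : ℝ :=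
  sSup {g : ℝ | g ∈ Set.Icc (0 : ℝ) 1 ∧ ConsistentInclusion p g}

/-- The supremum in the definition of the consistency gap is a maximum. -/
theorem isGreatest_consistencyGap (p : Fin N → ℝ) :
    IsGreatest {g : ℝ | g ∈ Set.Icc (0 : ℝ) 1 ∧ ConsistentInclusion p g} (consistencyGap p) := by
  have h0 : (0 : ℝ) ∈ {g : ℝ | g ∈ Set.Icc (0 : ℝ) 1 ∧ ConsistentInclusion p g} := by
    refine ⟨by simp, ?_⟩
    intro E₁ E₂ h q b hb hq
    obtain ⟨i, _⟩ := h.nonempty_left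
    have := (abs_nonneg _).trans (hq i)
    linarith
  have hbdd : BddAbove {g : ℝ | g ∈ Set.Icc (0 : ℝ) 1 ∧ ConsistentInclusion p g} :=
    ⟨1, fun g hg => hg.1.2⟩
  refine ⟨⟨⟨le_csSup hbdd h0, csSup_le ⟨0, h0⟩ fun g hg => hg.1.2⟩, ?_⟩,
    fun g hg => le_csSup hbdd hg⟩
  intro E₁ E₂ h q b hb
  obtain ⟨g, hg, hbg⟩ := exists_lt_of_lt_csSup ⟨0, h0⟩ hb
  exact hg.2 E₁ E₂ h q b hbg

/-! ### Successive Expert Elimination -/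

/-- Members of `C` whose estimate is at most that of `j`. -/
def lowerPart (q : Fin N → ℝ) (C : Finset (Fin N)) (j : Fin N) : Finset (Fin N) :=
  {k ∈ C | q k ≤ q j}

/-- Members of `C` whose estimate exceeds that of `j`. -/
def upperPart (q : Fin N → ℝ) (C : Finset (Fin N)) (j : Fin N) : Finset (Fin N) :=
  {k ∈ C | q j < q k}

/-- The sets formed by the best `1, 2, …, |L|` members of `L`, by estimated competency (all ways
of breaking ties are listed). -/
def topK (q : Fin N → ℝ) (L : Finset (Fin N)) : Finset (Finset (Fin N)) :=
  {E ∈ L.powerset | E.Nonempty ∧ ∀ a ∈ E, ∀ c ∈ L \ E, q c ≤ q a}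

/-- There is a breakage barrier right above `j`: `C` has members estimated above `j`, and each of
them is in breakage with `j` (hence with every member of `lowerPart q C j`). -/
def BarrierAbove (q : Fin N → ℝ) (b : ℝ) (C : Finset (Fin N)) (j : Fin N) : Prop :=
  (upperPart q C j).Nonempty ∧ ∀ i ∈ upperPart q C j, Breakage q b i j

/-- The removal test at `j`. -/
def RemovalTest (q : Fin N → ℝ) (b : ℝ) (C : Finset (Fin N)) (j : Fin N) : Prop :=
  ∀ E ∈ topK q (lowerPart q C j), conservativeAdvantage q b (upperPart q C j) E ≤ 0

open Classical in
/-- One iteration of the inner loop: process the (possible) breakage at expert `j`. -/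
def seeStep (q : Fin N → ℝ) (b : ℝ) (C : Finset (Fin N)) (j : Fin N) : Finset (Fin N) :=
  if j ∈ C ∧ BarrierAbove q b C j ∧ RemovalTest q b C j then C \ lowerPart q C j else C

open Classical in
/-- The update of the candidate committee in one round: all breakages are processed in descending
order of the estimated competencies. -/
def seeRound (q : Fin N → ℝ) (b : ℝ) (C : Finset (Fin N)) : Finset (Fin N) :=
  ((List.finRange N).insertionSort (fun i j => q j ≤ q i)).foldl (seeStep q b) C

/-- Confidence half-width after `t` samples, at confidence parameter `δ` and for sub-Gaussian
variance proxy `σ ^ 2`. -/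
def ucb (σ δ : ℝ) (t : ℕ) : ℝ :=
  √(2 * σ ^ 2 * Real.log (4 / δ) / t)

variable {𝒳 : Type*}

/-- Empirical competency of expert `i` after the first `t` contexts of the sequence `x`. -/
def empMean (score : Fin N → 𝒳 → ℝ) (x : ℕ → 𝒳) (t : ℕ) (i : Fin N) : ℝ :=
  (∑ s ∈ Finset.range t, score i (x s)) / t

/-- The candidate committee of the algorithm after `t` rounds (so it is the committee played in
round `t + 1`), run on the context sequence `x`. All members are queried in each round, hence each
of them has been sampled exactly `t` times. -/
def committee (score : Fin N → 𝒳 → ℝ) (σ δ : ℝ) (x : ℕ → 𝒳) : ℕ → Finset (Fin N)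
  | 0 => Finset.univ
  | t + 1 => seeRound (empMean score x (t + 1)) (ucb σ δ (t + 1)) (committee score σ δ x t)

/-- The competency of expert `i`: its expected score. -/
def competency [MeasurableSpace 𝒳] (P : Measure 𝒳) (score : Fin N → 𝒳 → ℝ) (i : Fin N) : ℝ :=
  ∫ x, score i x ∂P

/-- Cumulative regret over rounds `1, …, T` against the committee `E`, when `C t` is the committee
played in round `t + 1`. -/
def regret (p : Fin N → ℝ) (E : Finset (Fin N)) (C : ℕ → Finset (Fin N)) (T : ℕ) : ℝ :=
  ∑ t ∈ Finset.range T, (pMaj p E - pMaj p (C t))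

end SEE

end

noncomputable section

namespace SEE

variable {N : ℕ}

/-! ### The law of the number of correct votes -/

/-! The confidence intervals at level `δ = 1/T` are valid round by round, but a union bound over `T`
rounds and `N` experts only bounds the failure probability by `N/2`. So exact validity is demanded
only up to a round `n` of order `σ² log T / m² + 1`, where `m` is the smaller of the two gaps, and
later violations are charged in proportion to their size.

The combinatorial core is `advantage_pos_of_le`. Given `s` correct votes in `C`, the gain from
adding `D` is nonnegative for `s` below half of `C` and nonpositive above, so it changes sign once.
The number of correct votes has a log-concave law, and the resulting likelihood-ratio ordering keeps
a positive mean gain positive when members of `C` become weaker; a stronger `D` only raises the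
gain. Hence valid intervals never cost a member of the smallest optimal top committee `O`
(`isTop_and_subset_seeStep`). At round `n` the intervals are so short that all pairs are in
breakage, the consistency gap makes the test succeed right below `O`, and exactly `O` remains
(`seeRound_eq_of_isBestTop`).

After round `n`, intervals missed by at most `e` make one elimination lose at most `2Ne`: the same
monotonicity is applied to the competencies clipped at the conservative bounds
(`pMaj_le_pMaj_upperPart`). There are at most `N` eliminations, so the loss stays below `2N²e`
however many rounds follow. The maximal inequality `sub_width_le_sum_exp` makes the expectation of
`e` of order `N log T / T`.

Altogether the expected regret is at most `n + nN + 6N³(1 + log 2T)`. Competencies in the unit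
interval that are `m`-separated satisfy `Nm ≤ 2`, so the cubic term is absorbed into `N log T / m²`.
-/

/-- Expectation of `φ` at the number of correct votes of the committee `C`, whose members are
independently correct with probabilities `p i`. -/
def vote (p : Fin N → ℝ) (C : Finset (Fin N)) (φ : ℤ → ℝ) : ℝ :=
  ∑ S ∈ C.powerset, ((∏ i ∈ S, p i) * ∏ j ∈ C \ S, (1 - p j)) * φ S.card

theorem vote_empty (p : Fin N → ℝ) (φ : ℤ → ℝ) : vote p ∅ φ = φ 0 := by
  simp [vote]

theorem vote_insert (p : Fin N → ℝ) {C : Finset (Fin N)} {i : Fin N} (hi : i ∉ C) (φ : ℤ → ℝ) :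
    vote p (insert i C) φ = p i * vote p C (fun s => φ (s + 1)) + (1 - p i) * vote p C φ := by
  unfold vote
  rw [Finset.sum_powerset_insert hi, Finset.mul_sum, Finset.mul_sum, add_comm]
  congr 1
  · refine Finset.sum_congr rfl fun S hS => ?_
    have hSC := Finset.mem_powerset.1 hS
    have hiS : i ∉ S := fun h => hi (hSC h)
    rw [Finset.prod_insert hiS, Finset.card_insert_of_notMem hiS]
    have : insert i C \ insert i S = C \ S := by
      ext k; simp only [Finset.mem_sdiff, Finset.mem_insert]
      constructor
      · rintro ⟨h | h, h2⟩
        · exact absurd (Or.inl h) h2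
        · exact ⟨h, fun h3 => h2 (Or.inr h3)⟩
      · rintro ⟨h, h2⟩
        refine ⟨Or.inr h, ?_⟩
        rintro (rfl | h3)
        · exact hi h
        · exact h2 h3
    rw [this]
    push_cast
    ring
  · refine Finset.sum_congr rfl fun S hS => ?_
    have hSC := Finset.mem_powerset.1 hS
    have hiS : i ∉ S := fun h => hi (hSC h)
    rw [Finset.insert_sdiff_of_notMem _ hiS, Finset.prod_insert (by simp [hi])]
    ring

theorem vote_congr {p q : Fin N → ℝ} {C : Finset (Fin N)} (h : ∀ i ∈ C, p i = q i)
    (φ : ℤ → ℝ) : vote p C φ = vote q C φ := by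
  refine Finset.sum_congr rfl fun S hS => ?_
  have hSC := Finset.mem_powerset.1 hS
  congr 2
  · exact Finset.prod_congr rfl fun i hi => h i (hSC hi)
  · exact Finset.prod_congr rfl fun i hi => by rw [h i (Finset.mem_sdiff.1 hi).1]

theorem vote_const (p : Fin N → ℝ) (C : Finset (Fin N)) (c : ℝ) : vote p C (fun _ => c) = c := by
  induction C using Finset.induction_on with
  | empty => exact vote_empty _ _
  | insert i C hi ih => rw [vote_insert p hi, ih]; ring

theorem vote_sub (p : Fin N → ℝ) (C : Finset (Fin N)) (φ ψ : ℤ → ℝ) :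
    vote p C (fun s => φ s - ψ s) = vote p C φ - vote p C ψ := by
  unfold vote
  rw [← Finset.sum_sub_distrib]
  exact Finset.sum_congr rfl fun S _ => by ring

theorem vote_union (p : Fin N → ℝ) {C D : Finset (Fin N)} (h : Disjoint C D) (φ : ℤ → ℝ) :
    vote p (C ∪ D) φ = vote p C (fun s => vote p D (fun t => φ (s + t))) := by
  induction C using Finset.induction_on generalizing φ with
  | empty => simp [vote_empty]
  | insert i C hi ih =>
    rw [Finset.disjoint_insert_left] at h
    have hi' : i ∉ C ∪ D := by simp [hi, h.1]
    rw [Finset.insert_union, vote_insert p hi', vote_insert p hi, ih h.2, ih h.2]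
    simp only [add_right_comm]

theorem vote_mono_fun {p : Fin N → ℝ} {C : Finset (Fin N)} (hp : ∀ i ∈ C, p i ∈ Set.Icc (0 : ℝ) 1)
    {φ ψ : ℤ → ℝ} (h : ∀ s, φ s ≤ ψ s) : vote p C φ ≤ vote p C ψ := by
  refine Finset.sum_le_sum fun S hS => ?_
  have hSC := Finset.mem_powerset.1 hS
  refine mul_le_mul_of_nonneg_left (h _) (mul_nonneg ?_ ?_)
  · exact Finset.prod_nonneg fun i hi => (hp i (hSC hi)).1
  · exact Finset.prod_nonneg fun i hi => sub_nonneg.2 (hp i (Finset.mem_sdiff.1 hi).1).2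

theorem vote_mem_Icc {p : Fin N → ℝ} {C : Finset (Fin N)}
    (hp : ∀ i ∈ C, p i ∈ Set.Icc (0 : ℝ) 1) {φ : ℤ → ℝ} (h : ∀ s, φ s ∈ Set.Icc (0 : ℝ) 1) :
    vote p C φ ∈ Set.Icc (0 : ℝ) 1 := by
  constructor
  · simpa [vote_const] using vote_mono_fun hp (φ := fun _ => 0) fun s => (h s).1
  · simpa [vote_const] using vote_mono_fun hp (ψ := fun _ => 1) fun s => (h s).2

/-- Conditioning on one expert makes the expectation affine in that expert's competency, with slope
`E φ(S+1) - E φ(S) ≥ 0`. -/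
theorem vote_mono {p q : Fin N → ℝ} {C : Finset (Fin N)} (hp : ∀ i ∈ C, 0 ≤ p i)
    (hpq : ∀ i ∈ C, p i ≤ q i) (hq : ∀ i ∈ C, q i ≤ 1) {φ : ℤ → ℝ} (hφ : Monotone φ) :
    vote p C φ ≤ vote q C φ := by
  induction C using Finset.induction_on generalizing φ with
  | empty => simp [vote_empty]
  | insert i C hi ih =>
    rw [Finset.forall_mem_insert] at hp hpq hq
    rw [vote_insert p hi, vote_insert q hi]
    have h1 := ih hp.2 hpq.2 hq.2 hφ
    have h2 := ih hp.2 hpq.2 hq.2 (φ := fun s => φ (s + 1)) fun s t hst => hφ (by omega)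
    have h3 : vote q C φ ≤ vote q C (fun s => φ (s + 1)) :=
      vote_mono_fun (fun k hk => ⟨(hp.2 k hk).trans (hpq.2 k hk), hq.2 k hk⟩)
        fun s => hφ (by omega)
    nlinarith [mul_le_mul_of_nonneg_left h1 (sub_nonneg.2 (hpq.1.trans hq.1)),
      mul_le_mul_of_nonneg_left h2 hp.1,
      mul_le_mul_of_nonneg_left h3 (sub_nonneg.2 hpq.1)]

/-- Each expectation is affine in every single competency, with slope a difference of two numbers in
the unit interval; changing the competencies one at a time gives the `ℓ¹` bound. -/
theorem abs_vote_sub_le {p q : Fin N → ℝ} {C : Finset (Fin N)}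
    (hp : ∀ i ∈ C, p i ∈ Set.Icc (0 : ℝ) 1) (hq : ∀ i ∈ C, q i ∈ Set.Icc (0 : ℝ) 1)
    {φ : ℤ → ℝ} (h : ∀ s, φ s ∈ Set.Icc (0 : ℝ) 1) :
    |vote p C φ - vote q C φ| ≤ ∑ i ∈ C, |p i - q i| := by
  induction C using Finset.induction_on generalizing φ with
  | empty => simp [vote_empty]
  | insert i C hi ih =>
    rw [Finset.forall_mem_insert] at hp hq
    rw [vote_insert p hi, vote_insert q hi, Finset.sum_insert hi]
    have h1 := ih hp.2 hq.2 h
    have h2 := ih hp.2 hq.2 (φ := fun s => φ (s + 1)) fun s => h _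
    obtain ⟨h3, h4⟩ := vote_mem_Icc hq.2 h
    obtain ⟨h5, h6⟩ := vote_mem_Icc hq.2 (φ := fun s => φ (s + 1)) fun s => h _
    set A := vote p C φ
    set A' := vote q C φ
    set B := vote p C fun s => φ (s + 1)
    set B' := vote q C fun s => φ (s + 1)
    have e : p i * B + (1 - p i) * A - (q i * B' + (1 - q i) * A')
        = p i * (B - B') + (1 - p i) * (A - A') + (p i - q i) * (B' - A') := by ring
    rw [e]
    have a1 : |p i * (B - B')| ≤ p i * ∑ i ∈ C, |p i - q i| := by
      rw [abs_mul, abs_of_nonneg hp.1.1]; exact mul_le_mul_of_nonneg_left h2 hp.1.1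
    have a2 : |(1 - p i) * (A - A')| ≤ (1 - p i) * ∑ i ∈ C, |p i - q i| := by
      rw [abs_mul, abs_of_nonneg (sub_nonneg.2 hp.1.2)]
      exact mul_le_mul_of_nonneg_left h1 (sub_nonneg.2 hp.1.2)
    have a3 : |(p i - q i) * (B' - A')| ≤ |p i - q i| := by
      rw [abs_mul]
      exact mul_le_of_le_one_right (abs_nonneg _) (abs_le.2 ⟨by linarith, by linarith⟩)
    have := abs_add_three (p i * (B - B')) ((1 - p i) * (A - A')) ((p i - q i) * (B' - A'))
    linarith

/-- If the members of `D` can be matched with the members of `C` so that each is at least as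
competent as its partner, then `D` collects stochastically more correct votes. -/
theorem vote_le_of_dominated {p q : Fin N → ℝ} {C D : Finset (Fin N)} (hcard : C.card = D.card)
    (hp : ∀ i ∈ C, 0 ≤ p i) (hq : ∀ i ∈ D, q i ≤ 1)
    (hinter : ∀ i ∈ C, i ∈ D → p i ≤ q i) (hdiff : ∀ i ∈ C, i ∉ D → ∀ j ∈ D, j ∉ C → p i ≤ q j)
    {φ : ℤ → ℝ} (hφ : Monotone φ) : vote p C φ ≤ vote q D φ := by
  induction h : (C \ D).card generalizing D q with
  | zero =>
    have hCD : C = D := Finset.eq_of_subset_of_card_le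
      (Finset.sdiff_eq_empty_iff_subset.1 (Finset.card_eq_zero.1 h)) hcard.ge
    subst hCD
    exact vote_mono hp (fun i hi => hinter i hi hi) hq hφ
  | succ n ih =>
    obtain ⟨i, hi⟩ : (C \ D).Nonempty := Finset.card_pos.1 (by omega)
    have h' : (D \ C).card = n + 1 := by
      have h1 := Finset.card_sdiff_add_card_inter C D
      have h2 := Finset.card_sdiff_add_card_inter D C
      rw [Finset.inter_comm] at h2
      omega
    obtain ⟨j, hj⟩ : (D \ C).Nonempty := Finset.card_pos.1 (by omega)
    rw [Finset.mem_sdiff] at hi hj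
    have hij : i ≠ j := fun e => hi.2 (e ▸ hj.1)
    have hiD : i ∉ D.erase j := fun h => hi.2 (Finset.mem_of_mem_erase h)
    -- Rename `j` to `i` inside `D`, letting `i` carry the competency of `j`. This leaves the law
    -- unchanged and shrinks `C \ D`, which is why the induction generalizes `q`.
    have key : vote q D φ = vote (Function.update q i (q j)) (insert i (D.erase j)) φ := by
      conv_lhs => rw [← Finset.insert_erase hj.1]
      rw [vote_insert _ (Finset.notMem_erase j D), vote_insert _ hiD, Function.update_self]
      have : ∀ ψ, vote (Function.update q i (q j)) (D.erase j) ψ = vote q (D.erase j) ψ :=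
        fun ψ => vote_congr (fun k hk => Function.update_of_ne (by rintro rfl; exact hiD hk) _ _) ψ
      rw [this, this]
    rw [key]
    have hne : ∀ k ∈ D.erase j, k ≠ i := by rintro k hk rfl; exact hiD hk
    apply ih
    · rw [Finset.card_insert_of_notMem hiD, Finset.card_erase_of_mem hj.1, hcard]
      have := Finset.card_pos.2 ⟨j, hj.1⟩
      omega
    · intro k hk
      rcases Finset.mem_insert.1 hk with rfl | hk
      · simpa using hq j hj.1
      · rw [Function.update_of_ne (hne k hk)]; exact hq k (Finset.mem_of_mem_erase hk)
    · intro k hkC hk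
      rcases Finset.mem_insert.1 hk with rfl | hk
      · simpa using hdiff k hkC hi.2 j hj.1 hj.2
      · rw [Function.update_of_ne (hne k hk)]; exact hinter k hkC (Finset.mem_of_mem_erase hk)
    · intro k hkC hk l hl hlC
      rw [Finset.mem_insert, not_or, Finset.mem_erase, not_and] at hk
      have hkj : k ≠ j := by rintro rfl; exact hj.2 hkC
      rcases Finset.mem_insert.1 hl with rfl | hl
      · exact absurd hi.1 hlC
      · rw [Function.update_of_ne (hne l hl)]
        exact hdiff k hkC (hk.2 hkj) l (Finset.mem_of_mem_erase hl) hlC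
    · have : C \ insert i (D.erase j) = (C \ D).erase i := by
        ext k
        simp only [Finset.mem_sdiff, Finset.mem_insert, Finset.mem_erase, not_or, not_and]
        constructor
        · rintro ⟨h1, h2, h3⟩
          exact ⟨h2, h1, h3 (by rintro rfl; exact hj.2 h1)⟩
        · rintro ⟨h1, h2, h3⟩
          exact ⟨h2, h1, fun _ => h3⟩
      rw [this, Finset.card_erase_of_mem (Finset.mem_sdiff.2 hi), h]
      rfl

/-! ### Log-concavity and single crossing -/

/-- The probability of exactly `s` correct votes. -/
def voteProb (p : Fin N → ℝ) (C : Finset (Fin N)) (s : ℤ) : ℝ :=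
  vote p C (fun t => if t = s then 1 else 0)

theorem voteProb_insert (p : Fin N → ℝ) {C : Finset (Fin N)} {i : Fin N} (hi : i ∉ C) (s : ℤ) :
    voteProb p (insert i C) s = p i * voteProb p C (s - 1) + (1 - p i) * voteProb p C s := by
  unfold voteProb
  rw [vote_insert p hi]
  simp only [← eq_sub_iff_add_eq]

theorem voteProb_nonneg {p : Fin N → ℝ} {C : Finset (Fin N)}
    (hp : ∀ i ∈ C, p i ∈ Set.Icc (0 : ℝ) 1) (s : ℤ) : 0 ≤ voteProb p C s :=
  (vote_mem_Icc hp fun t => by split_ifs <;> simp).1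

/-- Adding an expert convolves the law with a two-point law. The two-index form of log-concavity,
rather than `s = t` alone, is what passes through the induction and also excludes internal zeros. -/
theorem voteProb_logConcave {p : Fin N → ℝ} {C : Finset (Fin N)}
    (hp : ∀ i ∈ C, p i ∈ Set.Icc (0 : ℝ) 1) {s t : ℤ} (hst : s ≤ t) :
    voteProb p C s * voteProb p C (t + 1) ≤ voteProb p C (s + 1) * voteProb p C t := by
  induction C using Finset.induction_on generalizing s t with
  | empty =>
    simp only [voteProb, vote_empty]
    split_ifs <;> first | omega | norm_num
  | insert i C hi ih =>
    rw [Finset.forall_mem_insert] at hp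
    -- The mixed terms need the chain `a(s-1)a(t+1) ≤ a(s)a(t) ≤ a(s+1)a(t-1)`, whose second link
    -- requires `s ≤ t - 1`; the case `s = t` is trivial.
    rcases hst.eq_or_lt with rfl | hlt
    · rw [mul_comm]
    simp only [voteProb_insert p hi, add_sub_cancel_right]
    have h1 := ih hp.2 (s := s - 1) (t := t - 1) (by omega)
    have h2 := ih hp.2 hst
    have h3 := ih hp.2 (s := s - 1) (t := t) (by omega)
    have h4 := ih hp.2 (s := s) (t := t - 1) (by omega)
    simp only [sub_add_cancel] at h1 h3 h4
    have hx := hp.1.1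
    have hy := sub_nonneg.2 hp.1.2
    nlinarith [mul_le_mul_of_nonneg_left h1 (mul_nonneg hx hx),
      mul_le_mul_of_nonneg_left h2 (mul_nonneg hy hy),
      mul_le_mul_of_nonneg_left (h3.trans h4) (mul_nonneg hx hy)]

theorem voteProb_card (p : Fin N → ℝ) (C : Finset (Fin N)) :
    voteProb p C C.card = ∏ i ∈ C, p i := by
  unfold voteProb vote
  rw [Finset.sum_eq_single C]
  · simp
  · intro S hS hne
    have : S.card ≠ C.card := fun h =>
      hne (Finset.eq_of_subset_of_card_le (Finset.mem_powerset.1 hS) h.ge)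
    simp [this]
  · simp

theorem vote_shift_eq_sum (p : Fin N → ℝ) (C : Finset (Fin N)) (φ : ℤ → ℝ) (d : ℤ)
    {I : Finset ℤ} (hI : Finset.Icc d (C.card + d) ⊆ I) :
    vote p C (fun s => φ (s + d)) = ∑ s ∈ I, voteProb p C (s - d) * φ s := by
  unfold voteProb vote
  simp only [Finset.sum_mul]
  rw [Finset.sum_comm]
  refine Finset.sum_congr rfl fun S hS => ?_
  have hS' := Finset.card_le_card (Finset.mem_powerset.1 hS)
  rw [Finset.sum_eq_single ((S.card : ℤ) + d)]
  · simp
  · intro s _ hs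
    rw [if_neg (by omega)]; simp
  · intro h
    exact absurd (hI (Finset.mem_Icc.2 ⟨by omega, by omega⟩)) h

/-- Adding a sure correct vote cannot make the expectation of a function positive that changes
sign at most once, from plus to minus. -/
theorem vote_shift_nonpos {p : Fin N → ℝ} {C : Finset (Fin N)}
    (hp : ∀ i ∈ C, 0 < p i ∧ p i ≤ 1) {φ : ℤ → ℝ} {m : ℤ} (hm : m ≤ C.card)
    (hpos : ∀ s ≤ m, 0 ≤ φ s) (hneg : ∀ s, m < s → φ s ≤ 0) (h : vote p C φ ≤ 0) :
    vote p C (fun s => φ (s + 1)) ≤ 0 := by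
  have hp' : ∀ i ∈ C, p i ∈ Set.Icc (0 : ℝ) 1 := fun i hi => ⟨(hp i hi).1.le, (hp i hi).2⟩
  have ha := voteProb_nonneg hp'
  have hlc : ∀ {s t : ℤ}, s ≤ t → voteProb p C s * voteProb p C (t + 1) ≤
    voteProb p C (s + 1) * voteProb p C t := voteProb_logConcave hp'
  have e0 := vote_shift_eq_sum p C φ 0 (I := Finset.Icc 0 (C.card + 1))
    (Finset.Icc_subset_Icc le_rfl (by omega))
  have e1 := vote_shift_eq_sum p C φ 1 (I := Finset.Icc 0 (C.card + 1))
    (Finset.Icc_subset_Icc (by omega) le_rfl)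
  simp only [add_zero, sub_zero] at e0
  rcases (ha m).eq_or_lt with h0 | h0
  -- The top probability `∏ p i` is positive, so by log-concavity a zero at `m` propagates to all
  -- smaller indices. The shifted law then lives where `φ ≤ 0`.
  · have hz : ∀ s ≤ m, voteProb p C s = 0 := by
      intro s hs
      induction s, hs using Int.leInductionDown with
      | base => exact h0.symm
      | pred s hs ih =>
        have := hlc (s := s - 1) (t := C.card - 1) (by omega)
        simp only [sub_add_cancel, ih, zero_mul, voteProb_card] at this
        have hprod : 0 < ∏ i ∈ C, p i := Finset.prod_pos fun i hi => (hp i hi).1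
        exact le_antisymm (nonpos_of_mul_nonpos_left this hprod) (ha _)
    rw [e1]
    refine Finset.sum_nonpos fun s _ => ?_
    rcases le_or_gt s m with hs | hs
    · rw [hz (s - 1) (by omega)]; simp
    · exact mul_nonpos_of_nonneg_of_nonpos (ha _) (hneg s hs)
  -- The ratio `a(s-1)/a(s)` increases in `s`; comparing it with its value at the sign change `m` is
  -- favourable on both sides, term by term.
  · have key : voteProb p C m * vote p C (fun s => φ (s + 1)) ≤
        voteProb p C (m - 1) * vote p C φ := by
      rw [e0, e1, Finset.mul_sum, Finset.mul_sum]
      refine Finset.sum_le_sum fun s _ => ?_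
      rcases le_or_gt s m with hs | hs
      · have := hlc (s := s - 1) (t := m - 1) (by omega)
        simp only [sub_add_cancel] at this
        nlinarith [mul_le_mul_of_nonneg_right this (hpos s hs)]
      · have := hlc (s := m - 1) (t := s - 1) (by omega)
        simp only [sub_add_cancel] at this
        nlinarith [mul_le_mul_of_nonneg_right this (neg_nonneg.2 (hneg s hs))]
    have := key.trans (mul_nonpos_of_nonneg_of_nonpos (ha (m - 1)) h)
    exact nonpos_of_mul_nonpos_right this h0

/-- Single crossing makes positivity survive weaker experts. Replace the entries of `q` by those of
`p` one at a time: the expectation is affine in the moved entry, and it suffices that it is positive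
at `0` and at the old value. -/
theorem vote_pos_of_le {p q : Fin N → ℝ} {C : Finset (Fin N)}
    (hp : ∀ i ∈ C, 0 < p i) (hpq : ∀ i ∈ C, p i ≤ q i) (hq : ∀ i ∈ C, q i ≤ 1)
    {φ : ℤ → ℝ} {m : ℤ} (hm : m < C.card)
    (hpos : ∀ s ≤ m, 0 ≤ φ s) (hneg : ∀ s, m < s → φ s ≤ 0) (h : 0 < vote q C φ) :
    0 < vote p C φ := by
  have key : ∀ D ⊆ C, 0 < vote (fun i => if i ∈ D then p i else q i) C φ := by
    intro D
    induction D using Finset.induction_on with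
    | empty => intro _; simpa using h
    | insert i D hi ih =>
      intro hD
      have hiC : i ∈ C := hD (Finset.mem_insert_self i D)
      have h1 := ih fun k hk => hD (Finset.mem_insert_of_mem hk)
      rw [← Finset.insert_erase hiC, vote_insert _ (Finset.notMem_erase i C)] at h1 ⊢
      have hc : ∀ ψ, vote (fun k => if k ∈ insert i D then p k else q k) (C.erase i) ψ
          = vote (fun k => if k ∈ D then p k else q k) (C.erase i) ψ := fun ψ =>
        vote_congr (fun k hk => by simp [(Finset.mem_erase.1 hk).1]) ψ
      rw [hc, hc]
      simp only [hi, if_false, Finset.mem_insert_self, if_true] at h1 ⊢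
      set V := vote (fun k => if k ∈ D then p k else q k) (C.erase i) φ
      set V' := vote (fun k => if k ∈ D then p k else q k) (C.erase i) fun s => φ (s + 1)
      have hcross : V ≤ 0 → V' ≤ 0 := by
        refine vote_shift_nonpos (fun k hk => ?_) (m := m) ?_ hpos hneg
        · have hk := Finset.mem_of_mem_erase hk
          split_ifs
          · exact ⟨hp k hk, (hpq k hk).trans (hq k hk)⟩
          · exact ⟨(hp k hk).trans_le (hpq k hk), hq k hk⟩
        · rw [Finset.card_erase_of_mem hiC]
          have := Finset.card_pos.2 ⟨i, hiC⟩
          omega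
      have hpi := hp i hiC
      have hpqi := hpq i hiC
      have hqi := hq i hiC
      -- If the value `V` at competency `0` were nonpositive, so would be the value `V'` at
      -- competency `1`, and hence every interpolation, against `h1`.
      have hV : 0 < V := by
        by_contra! hV
        nlinarith [hcross hV, mul_nonneg (sub_nonneg.2 hqi) (neg_nonneg.2 hV),
          mul_nonneg (hpi.le.trans hpqi) (neg_nonneg.2 (hcross hV))]
      rcases le_or_gt V V' with hVV | hVV
      · nlinarith
      · nlinarith [mul_nonneg (sub_nonneg.2 hpqi) (sub_nonneg.2 hVV.le)]
  refine (key C subset_rfl).trans_eq (vote_congr (fun i hi => by simp [hi]) φ)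

/-! ### Majority votes -/

/-- The probability that `s` correct votes out of `n` win, ties being broken by a fair coin. -/
def majority (n s : ℤ) : ℝ := if n < 2 * s then 1 else if 2 * s = n then 1 / 2 else 0

theorem majority_mem_Icc (n s : ℤ) : majority n s ∈ Set.Icc (0 : ℝ) 1 := by
  unfold majority; split_ifs <;> norm_num

theorem majority_monotone (n : ℤ) : Monotone (majority n) := by
  intro s t hst
  unfold majority
  split_ifs <;> first | omega | norm_num

theorem pMaj_eq_vote (p : Fin N → ℝ) {C : Finset (Fin N)} (hC : C.Nonempty) :
    pMaj p C = vote p C (majority C.card) := by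
  unfold pMaj vote
  rw [if_neg hC.ne_empty, Finset.sum_filter, Finset.sum_filter, Finset.mul_sum,
    ← Finset.sum_add_distrib]
  refine Finset.sum_congr rfl fun S _ => ?_
  unfold majority
  rcases lt_trichotomy C.card (2 * S.card) with h | h | h
  · rw [if_pos h, if_neg h.ne', if_pos (by exact_mod_cast h)]; ring
  · rw [if_neg h.not_lt, if_pos h.symm, if_neg (by exact_mod_cast h.not_lt),
      if_pos (by exact_mod_cast h.symm)]; ring
  · rw [if_neg h.not_gt, if_neg h.ne, if_neg (by exact_mod_cast h.not_gt),
      if_neg (by exact_mod_cast h.ne)]; ring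

theorem pMaj_empty (p : Fin N → ℝ) : pMaj p ∅ = 0 := if_pos rfl

theorem pMaj_mem_Icc {p : Fin N → ℝ} (hp : ∀ i, p i ∈ Set.Icc (0 : ℝ) 1) (C : Finset (Fin N)) :
    pMaj p C ∈ Set.Icc (0 : ℝ) 1 := by
  rcases C.eq_empty_or_nonempty with rfl | hC
  · simp [pMaj_empty]
  · rw [pMaj_eq_vote p hC]
    exact vote_mem_Icc (fun i _ => hp i) (majority_mem_Icc _)

theorem abs_pMaj_sub_le {p q : Fin N → ℝ} {C : Finset (Fin N)}
    (hp : ∀ i ∈ C, p i ∈ Set.Icc (0 : ℝ) 1) (hq : ∀ i ∈ C, q i ∈ Set.Icc (0 : ℝ) 1)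
    {e : ℝ} (he : 0 ≤ e) (h : ∀ i ∈ C, |p i - q i| ≤ e) : |pMaj p C - pMaj q C| ≤ N * e := by
  rcases C.eq_empty_or_nonempty with rfl | hC
  · simp only [pMaj_empty, sub_self, abs_zero]; positivity
  · rw [pMaj_eq_vote p hC, pMaj_eq_vote q hC]
    refine (abs_vote_sub_le hp hq (majority_mem_Icc _)).trans ((Finset.sum_le_sum h).trans ?_)
    rw [Finset.sum_const, nsmul_eq_mul]
    gcongr
    simpa using Finset.card_le_univ C

theorem advantage_eq_vote {p : Fin N → ℝ} {C D : Finset (Fin N)} (hC : C.Nonempty)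
    (h : Disjoint C D) : advantage p C D = vote p C (fun s =>
      vote p D (fun t => majority ((C.card : ℤ) + D.card) (s + t)) - majority C.card s) := by
  unfold advantage
  rw [pMaj_eq_vote p hC, pMaj_eq_vote p (hC.mono Finset.subset_union_left),
    vote_sub p C (fun s => vote p D (fun t => majority ((C.card : ℤ) + D.card) (s + t))),
    vote_union p h, Finset.card_union_of_disjoint h]
  push_cast
  rfl

/-- Whether adding `D` to `C` pays off is monotone: it keeps paying off if the members of `C`
become less competent and `D` is replaced by a more competent set of the same size. -/
theorem advantage_pos_of_le {p q : Fin N → ℝ} {C D D' : Finset (Fin N)} (hC : C.Nonempty)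
    (hCD : Disjoint C D) (hCD' : Disjoint C D') (hcard : D.card = D'.card)
    (hp : ∀ i ∈ C, 0 < p i) (hpq : ∀ i ∈ C, p i ≤ q i) (hq : ∀ i ∈ C, q i ≤ 1)
    (hqD : ∀ j ∈ D, 0 ≤ q j) (hpD : ∀ j ∈ D', p j ∈ Set.Icc (0 : ℝ) 1)
    (hinter : ∀ i ∈ D, i ∈ D' → q i ≤ p i)
    (hdiff : ∀ i ∈ D, i ∉ D' → ∀ j ∈ D', j ∉ D → q i ≤ p j)
    (h : 0 < advantage q C D) : 0 < advantage p C D' := by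
  rw [advantage_eq_vote hC hCD] at h
  rw [advantage_eq_vote hC hCD']
  set φ : ℤ → ℝ := fun s =>
    vote p D' (fun t => majority ((C.card : ℤ) + D'.card) (s + t)) - majority C.card s with hφ
  -- Below half of `C` the old committee surely loses, so additional votes cannot hurt; above half
  -- it surely wins, so they cannot help.
  have hpos : ∀ s : ℤ, 2 * s < C.card → 0 ≤ φ s := by
    intro s hs
    have : majority C.card s = 0 := by
      unfold majority; rw [if_neg (by omega), if_neg (by omega)]
    simp only [hφ, this, sub_zero]
    exact (vote_mem_Icc hpD fun t => majority_mem_Icc _ _).1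
  have hneg : ∀ s : ℤ, (C.card : ℤ) < 2 * s → φ s ≤ 0 := by
    intro s hs
    have : majority C.card s = 1 := by unfold majority; rw [if_pos (by omega)]
    simp only [hφ, this]
    have := (vote_mem_Icc hpD fun t => majority_mem_Icc (C.card + D'.card) (s + t)).2
    linarith
  have hqφ : 0 < vote q C φ := by
    refine h.trans_le (vote_mono_fun (fun i hi => ⟨((hp i hi).trans_le (hpq i hi)).le, hq i hi⟩)
      fun s => sub_le_sub_right ?_ _)
    rw [hcard]
    exact vote_le_of_dominated hcard hqD (fun j hj => (hpD j hj).2) hinter hdiff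
      fun a b hab => majority_monotone _ (by omega)
  have hcp := Finset.card_pos.2 hC
  -- Only a tie in `C` has an undetermined sign. Either sign leaves a single crossing, and only
  -- decides on which side of it the tie lies.
  by_cases hmid : ∀ s : ℤ, 2 * s = C.card → 0 ≤ φ s
  · by_cases h1 : C.card = 1
    · exact vote_pos_of_le hp hpq hq (m := 0) (by omega) (fun s hs => hpos s (by omega))
        (fun s hs => hneg s (by omega)) hqφ
    · refine vote_pos_of_le hp hpq hq (m := C.card / 2) (by omega) (fun s hs => ?_)
        (fun s hs => hneg s (by omega)) hqφ
      rcases eq_or_ne (2 * s) C.card with e | e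
      · exact hmid s e
      · exact hpos s (by omega)
  · push Not at hmid
    obtain ⟨s₀, hs₀, hs₀'⟩ := hmid
    refine vote_pos_of_le hp hpq hq (m := s₀ - 1) (by omega) (fun s hs => hpos s (by omega))
        (fun s hs => ?_) hqφ
    rcases eq_or_ne s s₀ with rfl | e
    · exact hs₀'.le
    · exact hneg s (by omega)

/-! ### Sets of most competent experts -/

/-- Each member of `C` is more competent than each non-member. -/
def IsTop (p : Fin N → ℝ) (C : Finset (Fin N)) : Prop := ∀ i ∈ C, ∀ j ∉ C, p j < p i

theorem IsTop.subset_or_subset {p : Fin N → ℝ} {C D : Finset (Fin N)} (hC : IsTop p C)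
    (hD : IsTop p D) : C ⊆ D ∨ D ⊆ C := by
  by_contra! h
  obtain ⟨i, hiC, hiD⟩ := Finset.not_subset.1 h.1
  obtain ⟨j, hjD, hjC⟩ := Finset.not_subset.1 h.2
  exact (hC i hiC j hjC).asymm (hD j hjD i hiD)

theorem exists_top_subset (q : Fin N → ℝ) (L : Finset (Fin N)) {m : ℕ} (hm : m ≤ L.card) :
    ∃ D ⊆ L, D.card = m ∧ ∀ a ∈ D, ∀ c ∈ L \ D, q c ≤ q a := by
  induction m with
  | zero => exact ⟨∅, by simp, rfl, by simp⟩
  | succ m ih =>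
    obtain ⟨D, hDL, hD, h⟩ := ih (by omega)
    have hne : (L \ D).Nonempty := by
      rw [← Finset.card_pos, Finset.card_sdiff_of_subset hDL]; omega
    obtain ⟨k, hk, hmax⟩ := Finset.exists_max_image (L \ D) q hne
    have hkD := (Finset.mem_sdiff.1 hk).2
    refine ⟨insert k D, Finset.insert_subset (Finset.mem_sdiff.1 hk).1 hDL, ?_, ?_⟩
    · rw [Finset.card_insert_of_notMem hkD, hD]
    · intro a ha c hc
      rw [Finset.mem_sdiff, Finset.mem_insert, not_or] at hc
      have hc' : c ∈ L \ D := Finset.mem_sdiff.2 ⟨hc.1, hc.2.2⟩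
      rcases Finset.mem_insert.1 ha with rfl | ha
      · exact hmax c hc'
      · exact h a ha c hc'

theorem pMaj_le_of_card_eq_of_isTop {p : Fin N → ℝ} (hp : ∀ i, p i ∈ Set.Icc (0 : ℝ) 1)
    {C D : Finset (Fin N)} (hcard : C.card = D.card) (hD : IsTop p D) : pMaj p C ≤ pMaj p D := by
  rcases C.eq_empty_or_nonempty with rfl | hC
  · rw [Finset.card_empty] at hcard
    rw [Finset.card_eq_zero.1 hcard.symm]
  · have hDne : D.Nonempty := Finset.card_pos.1 (hcard ▸ Finset.card_pos.2 hC)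
    rw [pMaj_eq_vote p hC, pMaj_eq_vote p hDne, hcard]
    exact vote_le_of_dominated hcard (fun i _ => (hp i).1) (fun i _ => (hp i).2)
      (fun _ _ _ => le_rfl) (fun i _ hi j hj _ => (hD j hj i hi).le) (majority_monotone _)

/-- The smallest optimal committee of most competent experts. -/
structure IsBestTop (p : Fin N → ℝ) (O : Finset (Fin N)) : Prop where
  isTop : IsTop p O
  nonempty : O.Nonempty
  optimal : IsOptimalCommittee p O
  lt_of_ssubset : ∀ C, IsTop p C → C.Nonempty → C ⊂ O → pMaj p C < pMaj p O

/-- Distinct competencies give a top committee of each size, which is best for that size. Choosing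
the smallest maximizer supplies the strict improvement over every smaller nonempty top committee
that the survival argument needs. -/
theorem exists_isBestTop {p : Fin N → ℝ} (hN : 0 < N) (hp : ∀ i, p i ∈ Set.Icc (0 : ℝ) 1)
    (hinj : Function.Injective p) : ∃ O, IsBestTop p O := by
  classical
  set 𝒯 : Finset (Finset (Fin N)) := {C | IsTop p C ∧ C.Nonempty} with h𝒯
  have hmem : ∀ C, C ∈ 𝒯 ↔ IsTop p C ∧ C.Nonempty := by simp [h𝒯]
  have huniv : Finset.univ ∈ 𝒯 :=
    (hmem _).2 ⟨fun i _ j hj => absurd (Finset.mem_univ j) hj, ⟨⟨0, hN⟩, Finset.mem_univ _⟩⟩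
  obtain ⟨M, hM, hMmax⟩ := Finset.exists_max_image 𝒯 (pMaj p) ⟨_, huniv⟩
  obtain ⟨O, hO, hOmin⟩ := Finset.exists_min_image {C ∈ 𝒯 | pMaj p M ≤ pMaj p C} Finset.card
    ⟨M, Finset.mem_filter.2 ⟨hM, le_rfl⟩⟩
  rw [Finset.mem_filter] at hO
  obtain ⟨hOtop, hOne⟩ := (hmem _).1 hO.1
  refine ⟨O, hOtop, hOne, fun C => ?_, fun C hC hCne hCO => ?_⟩
  · rcases C.eq_empty_or_nonempty with rfl | hC
    · rw [pMaj_empty]; exact (pMaj_mem_Icc hp O).1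
    · obtain ⟨D, -, hD, h⟩ := exists_top_subset p Finset.univ (Finset.card_le_univ C)
      have hDtop : IsTop p D := fun i hi j hj =>
        (h i hi j (by simp [hj])).lt_of_ne fun e => hj (hinj e ▸ hi)
      have hDne : D.Nonempty := Finset.card_pos.1 (hD ▸ Finset.card_pos.2 hC)
      exact (pMaj_le_of_card_eq_of_isTop hp hD.symm hDtop).trans
        ((hMmax D ((hmem _).2 ⟨hDtop, hDne⟩)).trans hO.2)
  · by_contra! hle
    have := hOmin C (Finset.mem_filter.2 ⟨(hmem _).2 ⟨hC, hCne⟩, hO.2.trans hle⟩)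
    exact (Finset.card_lt_card hCO).not_ge this

/-! ### One elimination -/

theorem lowerPart_eq_sdiff (q : Fin N → ℝ) (C : Finset (Fin N)) (j : Fin N) :
    lowerPart q C j = C \ upperPart q C j := by
  ext k; simp only [lowerPart, upperPart, Finset.mem_filter, Finset.mem_sdiff]
  constructor
  · rintro ⟨h1, h2⟩; exact ⟨h1, fun h3 => h2.not_gt h3.2⟩
  · rintro ⟨h1, h2⟩; exact ⟨h1, not_lt.1 fun h3 => h2 ⟨h1, h3⟩⟩

theorem sdiff_lowerPart (q : Fin N → ℝ) (C : Finset (Fin N)) (j : Fin N) :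
    C \ lowerPart q C j = upperPart q C j := by
  rw [lowerPart_eq_sdiff, Finset.sdiff_sdiff_eq_self (show upperPart q C j ⊆ C from Finset.filter_subset _ _)]

theorem upperPart_union_lowerPart (q : Fin N → ℝ) (C : Finset (Fin N)) (j : Fin N) :
    upperPart q C j ∪ lowerPart q C j = C := by
  rw [lowerPart_eq_sdiff, Finset.union_sdiff_of_subset (show upperPart q C j ⊆ C from Finset.filter_subset _ _)]

theorem disjoint_upperPart_lowerPart (q : Fin N → ℝ) (C : Finset (Fin N)) (j : Fin N) :
    Disjoint (upperPart q C j) (lowerPart q C j) := by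
  rw [lowerPart_eq_sdiff]; exact Finset.disjoint_sdiff

theorem seeStep_subset (q : Fin N → ℝ) (b : ℝ) (C : Finset (Fin N)) (j : Fin N) :
    seeStep q b C j ⊆ C := by
  unfold seeStep; split_ifs
  · exact Finset.sdiff_subset
  · exact subset_rfl

theorem BarrierAbove.breakage {q : Fin N → ℝ} {b : ℝ} {C : Finset (Fin N)} {j : Fin N}
    (h : BarrierAbove q b C j) {i k : Fin N} (hi : i ∈ upperPart q C j)
    (hk : k ∈ lowerPart q C j) : Breakage q b i k := by
  have h1 := h.2 i hi
  have h2 := (Finset.mem_filter.1 hk).2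
  unfold Breakage at *
  linarith

theorem conservative_of_mem {q : Fin N → ℝ} {b : ℝ} {E : Finset (Fin N)} {i : Fin N}
    (h : i ∈ E) : conservative q b E i = q i + b := if_pos h

theorem conservative_of_notMem {q : Fin N → ℝ} {b : ℝ} {E : Finset (Fin N)} {i : Fin N}
    (h : i ∉ E) : conservative q b E i = q i - b := if_neg h

/-- A breakage between `E₁` and `E₂` keeps the conservative estimates inside the unit interval. -/
theorem conservative_bounds {q : Fin N → ℝ} {b : ℝ} (hb : 0 ≤ b)
    (hq : ∀ i, q i ∈ Set.Icc (0 : ℝ) 1) {E₁ E₂ : Finset (Fin N)} (h₁ : E₁.Nonempty)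
    (h₂ : E₂.Nonempty) (hbr : ∀ i ∈ E₁, ∀ j ∈ E₂, Breakage q b i j) :
    (∀ i ∈ E₁, 0 < q i - b ∧ q i - b ≤ 1) ∧ ∀ j ∈ E₂, q j + b ∈ Set.Icc (0 : ℝ) 1 := by
  obtain ⟨k, hk⟩ := h₁
  obtain ⟨l, hl⟩ := h₂
  constructor
  · intro i hi
    have := hbr i hi l hl
    have h1 := hq l
    have h2 := hq i
    unfold Breakage at this
    exact ⟨by linarith [h1.1], by linarith [h2.2]⟩
  · intro j hj
    have := hbr k hk j hj
    have h1 := hq k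
    have h2 := hq j
    unfold Breakage at this
    exact ⟨by linarith [h2.1], by linarith [h1.2]⟩

/-- An elimination is harmless up to the amount by which the confidence intervals are missed. -/
theorem pMaj_le_pMaj_upperPart {p q : Fin N → ℝ} (hp : ∀ i, p i ∈ Set.Icc (0 : ℝ) 1)
    (hq : ∀ i, q i ∈ Set.Icc (0 : ℝ) 1) {b e : ℝ} (hb : 0 ≤ b) (he : 0 ≤ e)
    (hpq : ∀ i, |q i - p i| ≤ b + e) {C : Finset (Fin N)} {j : Fin N} (hj : j ∈ C)
    (hbar : BarrierAbove q b C j) (htest : RemovalTest q b C j) :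
    pMaj p C ≤ pMaj p (upperPart q C j) + 2 * N * e := by
  set U := upperPart q C j with hU
  set L := lowerPart q C j with hL
  have hLne : L.Nonempty := ⟨j, Finset.mem_filter.2 ⟨hj, le_rfl⟩⟩
  have hdisj : Disjoint U L := disjoint_upperPart_lowerPart q C j
  have hUL : U ∪ L = C := upperPart_union_lowerPart q C j
  have hbr : ∀ i ∈ U, ∀ k ∈ L, Breakage q b i k := fun i hi k hk => hbar.breakage hi hk
  obtain ⟨hbU, hbL⟩ := conservative_bounds hb hq hbar.1 hLne hbr
  -- Among all tested sets only the whole lower part matters here, since it is what gets removed.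
  have hca : conservativeAdvantage q b U L ≤ 0 :=
    htest L (Finset.mem_filter.2
    ⟨Finset.mem_powerset_self _, hLne, fun a _ c hc => by simp [← hL] at hc⟩)
  have hnL : ∀ i ∈ U, i ∉ L := fun i hi => Finset.disjoint_left.1 hdisj hi
  -- The true competencies, clipped so that `r` respects the conservative bounds: at least `q - b`
  -- on `U`, at most `q + b` on `L`. Clipping moves no entry by more than `e`.
  set r : Fin N → ℝ := fun i => if i ∈ L then min (p i) (q i + b) else max (p i) (q i - b) with hr
  have hrL : ∀ i ∈ L, r i = min (p i) (q i + b) := fun i hi => if_pos hi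
  have hrU : ∀ i ∈ U, r i = max (p i) (q i - b) := fun i hi => if_neg (hnL i hi)
  have hrC : ∀ i ∈ C, r i ∈ Set.Icc (0 : ℝ) 1 := by
    intro i hi
    rw [← hUL, Finset.mem_union] at hi
    rcases hi with hi | hi
    · rw [hrU i hi]
      exact ⟨le_max_of_le_left (hp i).1, max_le (hp i).2 (hbU i hi).2⟩
    · rw [hrL i hi]
      exact ⟨le_min (hp i).1 (hbL i hi).1, min_le_of_left_le (hp i).2⟩
  have hrp : ∀ i ∈ C, |p i - r i| ≤ e := by
    intro i hi
    have := abs_le.1 (hpq i)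
    rw [← hUL, Finset.mem_union] at hi
    rcases hi with hi | hi
    · rw [hrU i hi]
      rcases max_cases (p i) (q i - b) with h | h <;> rw [h.1, abs_le] <;>
        constructor <;> linarith
    · rw [hrL i hi]
      rcases min_cases (p i) (q i + b) with h | h <;> rw [h.1, abs_le] <;>
        constructor <;> linarith
  have hr0 : advantage r U L ≤ 0 := by
    by_contra! hpos
    refine hca.not_gt (advantage_pos_of_le hbar.1 hdisj hdisj rfl ?_ ?_ ?_ ?_ ?_ ?_ ?_ hpos)
    · intro i hi
      rw [conservative_of_notMem (hnL i hi)]; exact (hbU i hi).1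
    · intro i hi
      rw [conservative_of_notMem (hnL i hi), hrU i hi]; exact le_max_right _ _
    · intro i hi
      exact (hrC i (hUL ▸ Finset.mem_union_left _ hi)).2
    · intro i hi
      exact (hrC i (hUL ▸ Finset.mem_union_right _ hi)).1
    · intro i hi
      rw [conservative_of_mem hi]; exact hbL i hi
    · intro i hi _
      rw [conservative_of_mem hi, hrL i hi]; exact min_le_right _ _
    · intro i hi hi'
      exact absurd hi hi'
  unfold advantage at hr0
  rw [hUL] at hr0
  have h1 := abs_le.1 (abs_pMaj_sub_le (C := C) (fun i _ => hp i) hrC he hrp)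
  have hUC : U ⊆ C := Finset.filter_subset _ _
  have h2 := abs_le.1 (abs_pMaj_sub_le (C := U) (fun i _ => hp i) (fun i hi => hrC i (hUC hi)) he
    fun i hi => hrp i (hUC hi))
  linarith [h1.2, h2.1]

/-- The potential `2Ne · |C|` pays for the error: an elimination removes at least the expert `j`, so
the total loss over any number of rounds is bounded by the initial size. -/
theorem pMaj_le_pMaj_seeStep {p q : Fin N → ℝ} (hp : ∀ i, p i ∈ Set.Icc (0 : ℝ) 1)
    (hq : ∀ i, q i ∈ Set.Icc (0 : ℝ) 1) {b e : ℝ} (hb : 0 ≤ b) (he : 0 ≤ e)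
    (hpq : ∀ i, |q i - p i| ≤ b + e) (C : Finset (Fin N)) (j : Fin N) :
    pMaj p C + 2 * N * e * (seeStep q b C j).card ≤
      pMaj p (seeStep q b C j) + 2 * N * e * C.card := by
  unfold seeStep
  split_ifs with h
  · obtain ⟨hj, hbar, htest⟩ := h
    rw [sdiff_lowerPart]
    have h1 := pMaj_le_pMaj_upperPart hp hq hb he hpq hj hbar htest
    have h2 : (upperPart q C j).card + 1 ≤ C.card := by
      refine Finset.card_lt_card ((Finset.filter_subset _ _).ssubset_of_ne fun h => ?_)
      rw [← h] at hj
      exact lt_irrefl _ (Finset.mem_filter.1 hj).2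
    have h3 : ((upperPart q C j).card : ℝ) + 1 ≤ C.card := by exact_mod_cast h2
    nlinarith [mul_le_mul_of_nonneg_left h3 (by positivity : (0 : ℝ) ≤ 2 * N * e)]
  · exact le_rfl

theorem pMaj_le_pMaj_seeRound {p q : Fin N → ℝ} (hp : ∀ i, p i ∈ Set.Icc (0 : ℝ) 1)
    (hq : ∀ i, q i ∈ Set.Icc (0 : ℝ) 1) {b e : ℝ} (hb : 0 ≤ b) (he : 0 ≤ e)
    (hpq : ∀ i, |q i - p i| ≤ b + e) (C : Finset (Fin N)) :
    pMaj p C + 2 * N * e * (seeRound q b C).card ≤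
      pMaj p (seeRound q b C) + 2 * N * e * C.card := by
  unfold seeRound
  induction (List.finRange N).insertionSort (fun i j => q j ≤ q i) generalizing C with
  | nil => exact le_rfl
  | cons j l ih =>
    rw [List.foldl_cons]
    linarith [ih (seeStep q b C j), pMaj_le_pMaj_seeStep hp hq hb he hpq C j]

/-! ### Rounds with valid confidence intervals -/

/-- With valid confidence intervals no member of the best committee is ever eliminated. -/
theorem isTop_and_subset_seeStep {p q : Fin N → ℝ} (hp : ∀ i, p i ∈ Set.Icc (0 : ℝ) 1)
    (hq : ∀ i, q i ∈ Set.Icc (0 : ℝ) 1) {b : ℝ} (hpq : ∀ i, |q i - p i| ≤ b)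
    {O C : Finset (Fin N)} (hO : IsBestTop p O) (hC : IsTop p C) (hOC : O ⊆ C) (j : Fin N) :
    IsTop p (seeStep q b C j) ∧ O ⊆ seeStep q b C j := by
  have hb : 0 ≤ b := by
    obtain ⟨i, _⟩ := hO.nonempty
    exact (abs_nonneg _).trans (hpq i)
  unfold seeStep
  split_ifs with h
  swap
  · exact ⟨hC, hOC⟩
  obtain ⟨hj, hbar, htest⟩ := h
  rw [sdiff_lowerPart]
  set U := upperPart q C j with hU
  set L := lowerPart q C j with hL
  have hLne : L.Nonempty := ⟨j, Finset.mem_filter.2 ⟨hj, le_rfl⟩⟩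
  have hdisj : Disjoint U L := disjoint_upperPart_lowerPart q C j
  have hUL : U ∪ L = C := upperPart_union_lowerPart q C j
  have hUC : U ⊆ C := Finset.filter_subset _ _
  have hbr : ∀ i ∈ U, ∀ k ∈ L, Breakage q b i k := fun i hi k hk => hbar.breakage hi hk
  have hUtop : IsTop p U := by
    intro i hi k hk
    by_cases hkC : k ∈ C
    · have hkL : k ∈ L := by
        rw [← hUL, Finset.mem_union] at hkC; exact hkC.resolve_left hk
      have h1 := hbr i hi k hkL
      unfold Breakage at h1
      linarith [(abs_le.1 (hpq i)).2, (abs_le.1 (hpq k)).1]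
    · exact hC i (hUC hi) k hkC
  refine ⟨hUtop, ?_⟩
  by_contra hnOU
  -- Top sets form a chain, so a cut into `O` leaves a proper subset of it, to which adding `O \ U`
  -- strictly helps.
  have hUO : U ⊂ O := ssubset_iff_subset_not_subset.2
    ⟨(hO.isTop.subset_or_subset hUtop).resolve_left hnOU, hnOU⟩
  have hOUL : O \ U ⊆ L := by
    rw [hL, lowerPart_eq_sdiff]; exact Finset.sdiff_subset_sdiff hOC subset_rfl
  -- The test sees the empirically best experts instead of `O \ U`. An empirical top set of the same
  -- size looks, with optimistic estimates, at least as good, so its conservative advantage is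
  -- positive too.
  obtain ⟨D, hDL, hDcard, hD⟩ := exists_top_subset q L (Finset.card_le_card hOUL)
  have hDne : D.Nonempty := Finset.card_pos.1
    (hDcard ▸ Finset.card_pos.2 (Finset.sdiff_nonempty.2 hUO.2))
  have hUD : Disjoint U D := hdisj.mono_right hDL
  have hnD : ∀ i ∈ U, i ∉ D := fun i hi => Finset.disjoint_left.1 hUD hi
  obtain ⟨hbU, hbL⟩ := conservative_bounds hb hq hbar.1 hLne hbr
  refine (htest D (Finset.mem_filter.2 ⟨Finset.mem_powerset.2 hDL, hDne, hD⟩)).not_gt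
    (advantage_pos_of_le (q := p) (D := O \ U) hbar.1 Finset.disjoint_sdiff hUD hDcard.symm
      ?_ ?_ (fun i _ => (hp i).2) (fun i _ => (hp i).1) ?_ ?_ ?_ ?_)
  · intro i hi
    rw [conservative_of_notMem (hnD i hi)]; exact (hbU i hi).1
  · intro i hi
    rw [conservative_of_notMem (hnD i hi)]; linarith [(abs_le.1 (hpq i)).2]
  · intro i hi
    rw [conservative_of_mem hi]; exact hbL i (hDL hi)
  · intro i _ hi
    rw [conservative_of_mem hi]; linarith [(abs_le.1 (hpq i)).1]
  · intro i hi hiD k hk _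
    rw [conservative_of_mem hk]
    linarith [(abs_le.1 (hpq i)).1, hD k hk i (Finset.mem_sdiff.2 ⟨hOUL hi, hiD⟩)]
  · unfold advantage
    rw [Finset.union_sdiff_of_subset hUO.1]
    exact sub_pos.2 (hO.lt_of_ssubset U hUtop hbar.1 hUO)

theorem isTop_and_subset_foldl_seeStep {p q : Fin N → ℝ} (hp : ∀ i, p i ∈ Set.Icc (0 : ℝ) 1)
    (hq : ∀ i, q i ∈ Set.Icc (0 : ℝ) 1) {b : ℝ} (hpq : ∀ i, |q i - p i| ≤ b)
    {O C : Finset (Fin N)} (hO : IsBestTop p O) (hC : IsTop p C) (hOC : O ⊆ C)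
    (l : List (Fin N)) :
    IsTop p (l.foldl (seeStep q b) C) ∧ O ⊆ l.foldl (seeStep q b) C := by
  induction l generalizing C with
  | nil => exact ⟨hC, hOC⟩
  | cons j l ih =>
    obtain ⟨h1, h2⟩ := isTop_and_subset_seeStep hp hq hpq hO hC hOC j
    exact ih h1 h2

theorem foldl_seeStep_subset (q : Fin N → ℝ) (b : ℝ) (C : Finset (Fin N)) (l : List (Fin N)) :
    l.foldl (seeStep q b) C ⊆ C := by
  induction l generalizing C with
  | nil => exact subset_rfl
  | cons j l ih => exact (ih _).trans (seeStep_subset q b C j)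

/-- Once the confidence intervals are valid and short, the best expert outside the best committee
triggers the elimination of everyone outside it. -/
theorem seeStep_eq_of_isBestTop {p q : Fin N → ℝ} {b ε : ℝ} (hpq : ∀ i, |q i - p i| ≤ b)
    (hε : 4 * b < ε) (hgap : ∀ i j, i ≠ j → ε ≤ |p i - p j|)
    (hb : 2 * b < consistencyGap p) {O C : Finset (Fin N)} (hO : IsBestTop p O)
    (hC : IsTop p C) (hOC : O ⊆ C) {j : Fin N} (hjO : j ∉ O) (hjC : j ∈ C)
    (hj : ∀ k ∈ C, k ∉ O → p k ≤ p j) : seeStep q b C j = O := by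
  -- Each estimate is off by at most `b`, so a true gap above `4b` leaves an empirical gap above
  -- `2b`. In particular the empirical order is the true one.
  have hlt : ∀ i k, p k < p i → Breakage q b i k := by
    intro i k hik
    have h1 := hgap i k (by rintro rfl; exact lt_irrefl _ hik)
    rw [abs_of_pos (sub_pos.2 hik)] at h1
    unfold Breakage
    linarith [(abs_le.1 (hpq i)).1, (abs_le.1 (hpq k)).2]
  have hb0 : 0 ≤ b := (abs_nonneg _).trans (hpq j)
  have hqlt : ∀ i k, p k < p i → q k < q i := by
    intro i k hik
    have := hlt i k hik
    unfold Breakage at this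
    linarith
  have hinj : ∀ i k, i ≠ k → p i < p k ∨ p k < p i := by
    intro i k hik
    rcases lt_trichotomy (p i) (p k) with h | h | h
    · exact Or.inl h
    · have := hgap i k hik
      rw [h, sub_self, abs_zero] at this
      linarith
    · exact Or.inr h
  have hU : upperPart q C j = O := by
    ext k
    simp only [upperPart, Finset.mem_filter]
    constructor
    · rintro ⟨hk, hjk⟩
      by_contra hkO
      rcases hinj k j (by rintro rfl; exact lt_irrefl _ hjk) with h | h
      · exact hjk.not_gt (hqlt _ _ h)
      · exact h.not_ge (hj k hk hkO)
    · intro hk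
      exact ⟨hOC hk, hqlt _ _ (hO.isTop k hk j hjO)⟩
  have hdisj := hU ▸ disjoint_upperPart_lowerPart q C j
  have hL : lowerPart q C j = C \ O := hU ▸ lowerPart_eq_sdiff q C j
  have hbar : BarrierAbove q b C j := by
    unfold BarrierAbove
    rw [hU]
    exact ⟨hO.nonempty, fun i hi => hlt _ _ (hO.isTop i hi j hjO)⟩
  have htest : RemovalTest q b C j := by
    intro E hE
    rw [hU]
    obtain ⟨hEL, hEne, hE⟩ := Finset.mem_filter.1 hE
    rw [Finset.mem_powerset, hL] at hEL
    have htop : IsTopPair p O E := by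
      refine ⟨hO.nonempty, hEne, hdisj.mono_right (hL ▸ hEL), hO.isTop, fun i hi k hk => ?_⟩
      rw [Finset.mem_union, not_or] at hk
      rcases Finset.mem_union.1 hi with hi | hi
      · exact hO.isTop i hi k hk.1
      · have hiC := Finset.mem_sdiff.1 (hEL hi)
        by_cases hkC : k ∈ C
        · have hqk := hE i hi k (by simp [hL, hkC, hk.1, hk.2])
          rcases hinj i k (by rintro rfl; exact hk.2 hi) with h | h
          · exact absurd (hqlt _ _ h) hqk.not_gt
          · exact h
        · exact hC i hiC.1 k hkC
    have hcons := (isGreatest_consistencyGap p).1.2 O E htop q b hb hpq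
      fun i hi k hk => hlt _ _ (hO.isTop i hi k (Finset.mem_sdiff.1 (hEL hk)).2)
    refine not_lt.1 fun h => (hcons.1 h).not_ge ?_
    exact sub_nonpos.2 (hO.optimal _)
  unfold seeStep
  rw [if_pos ⟨hjC, hbar, htest⟩, sdiff_lowerPart, hU]

/-- Consider the best expert `j` outside `O`. If it survives until its turn, its step leaves `O`; if
it was removed before, the remaining top set contains nobody weaker and already equals `O`. Later
steps keep `O`. -/
theorem seeRound_eq_of_isBestTop {p q : Fin N → ℝ} (hp : ∀ i, p i ∈ Set.Icc (0 : ℝ) 1)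
    (hq : ∀ i, q i ∈ Set.Icc (0 : ℝ) 1) {b ε : ℝ} (hpq : ∀ i, |q i - p i| ≤ b)
    (hε : 4 * b < ε) (hgap : ∀ i j, i ≠ j → ε ≤ |p i - p j|)
    (hb : 2 * b < consistencyGap p) {O C : Finset (Fin N)} (hO : IsBestTop p O)
    (hC : IsTop p C) (hOC : O ⊆ C) : seeRound q b C = O := by
  unfold seeRound
  set l := (List.finRange N).insertionSort (fun i j => q j ≤ q i) with hl
  have hsub := foldl_seeStep_subset q b C l
  by_cases hne : (C \ O).Nonempty
  swap
  · have hCO : C ⊆ O := Finset.sdiff_eq_empty_iff_subset.1 (Finset.not_nonempty_iff_eq_empty.1 hne)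
    exact (hsub.trans hCO).antisymm (isTop_and_subset_foldl_seeStep hp hq hpq hO hC hOC l).2
  obtain ⟨j, hj, hmax⟩ := Finset.exists_max_image (C \ O) p hne
  rw [Finset.mem_sdiff] at hj
  have hjl : j ∈ l := ((List.perm_insertionSort _ _).mem_iff).2 (List.mem_finRange j)
  obtain ⟨l₁, l₂, hl12⟩ := List.append_of_mem hjl
  rw [hl12, List.foldl_append, List.foldl_cons]
  have hsub₁ := foldl_seeStep_subset q b C l₁
  obtain ⟨htop, hOD⟩ := isTop_and_subset_foldl_seeStep hp hq hpq hO hC hOC l₁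
  set D := l₁.foldl (seeStep q b) C with hD
  have hmid : seeStep q b D j = O := by
    by_cases hjD : j ∈ D
    · exact seeStep_eq_of_isBestTop hpq hε hgap hb hO htop hOD hj.2 hjD
        fun k hk hkO => hmax k (Finset.mem_sdiff.2 ⟨hsub₁ hk, hkO⟩)
    · have hDO : D = O := by
        refine Finset.Subset.antisymm (fun k hk => ?_) hOD
        by_contra hkO
        exact (htop k hk j hjD).not_ge (hmax k (Finset.mem_sdiff.2 ⟨hsub₁ hk, hkO⟩))
      unfold seeStep
      rw [if_neg fun h => hjD h.1, hDO]
  rw [hmid]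
  exact (foldl_seeStep_subset q b O l₂).antisymm
    (isTop_and_subset_foldl_seeStep hp hq hpq hO hO.isTop subset_rfl l₂).2

/-! ### Pathwise regret -/

section Run

variable {𝒳 : Type*} {score : Fin N → 𝒳 → ℝ} {σ δ : ℝ} {x : ℕ → 𝒳}

theorem ucb_nonneg (σ δ : ℝ) (t : ℕ) : 0 ≤ ucb σ δ t := Real.sqrt_nonneg _

theorem empMean_mem_Icc (hs : ∀ i y, score i y ∈ Set.Icc (0 : ℝ) 1) (x : ℕ → 𝒳) (t : ℕ)
    (i : Fin N) : empMean score x t i ∈ Set.Icc (0 : ℝ) 1 := by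
  unfold empMean
  refine ⟨div_nonneg (Finset.sum_nonneg fun s _ => (hs i _).1) t.cast_nonneg,
    div_le_one_of_le₀ ?_ t.cast_nonneg⟩
  simpa using Finset.sum_le_sum fun s (_ : s ∈ Finset.range t) => (hs i (x s)).2

theorem isTop_and_subset_committee {p : Fin N → ℝ} (hp : ∀ i, p i ∈ Set.Icc (0 : ℝ) 1)
    (hs : ∀ i y, score i y ∈ Set.Icc (0 : ℝ) 1) {O : Finset (Fin N)} (hO : IsBestTop p O) (n : ℕ)
    (h : ∀ t ∈ Finset.Icc 1 n, ∀ i, |empMean score x t i - p i| ≤ ucb σ δ t) :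
    IsTop p (committee score σ δ x n) ∧ O ⊆ committee score σ δ x n := by
  induction n with
  | zero => exact ⟨fun i _ j hj => absurd (Finset.mem_univ j) hj, Finset.subset_univ _⟩
  | succ n ih =>
    obtain ⟨h1, h2⟩ := ih fun t ht => h t (by simp at ht ⊢; omega)
    exact isTop_and_subset_foldl_seeStep hp (empMean_mem_Icc hs x _)
      (h (n + 1) (by simp)) hO h1 h2 _

/-- If the confidence intervals are valid up to round `n`, at which they are short, and are missed
by at most `e` afterwards, then the later committees are optimal up to an error of order `e`. -/
theorem pMaj_sub_pMaj_committee_le {p : Fin N → ℝ} (hp : ∀ i, p i ∈ Set.Icc (0 : ℝ) 1)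
    (hs : ∀ i y, score i y ∈ Set.Icc (0 : ℝ) 1) {O : Finset (Fin N)} (hO : IsBestTop p O)
    {n m : ℕ} (hn : 1 ≤ n) (hnm : n ≤ m)
    (h : ∀ t ∈ Finset.Icc 1 n, ∀ i, |empMean score x t i - p i| ≤ ucb σ δ t)
    {ε : ℝ} (hε : 4 * ucb σ δ n < ε) (hgap : ∀ i j, i ≠ j → ε ≤ |p i - p j|)
    (hb : 2 * ucb σ δ n < consistencyGap p) {e : ℝ} (he : 0 ≤ e)
    (h' : ∀ t ∈ Finset.Ioc n m, ∀ i, |empMean score x t i - p i| ≤ ucb σ δ t + e) :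
    pMaj p O - pMaj p (committee score σ δ x m) ≤ 2 * N ^ 2 * e := by
  have key : pMaj p O + 2 * N * e * (committee score σ δ x m).card ≤
      pMaj p (committee score σ δ x m) + 2 * N * e * N := by
    induction m, hnm using Nat.le_induction with
    | base =>
      obtain ⟨k, rfl⟩ : ∃ k, n = k + 1 := ⟨n - 1, by omega⟩
      obtain ⟨h1, h2⟩ := isTop_and_subset_committee (x := x) (σ := σ) (δ := δ) hp hs hO k
        fun t ht => h t (by simp at ht ⊢; omega)
      have : committee score σ δ x (k + 1) = O :=
        seeRound_eq_of_isBestTop hp (empMean_mem_Icc hs x _) (h (k + 1) (by simp)) (by simpa using hε)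
          hgap (by simpa using hb) hO h1 h2
      rw [this]
      gcongr
      simpa using Finset.card_le_univ O
    | succ m hnm ih =>
      have h1 := ih fun t ht => h' t (by simp at ht ⊢; omega)
      have h2 := pMaj_le_pMaj_seeRound hp (empMean_mem_Icc hs x (m + 1)) (ucb_nonneg σ δ (m + 1)) he
        (h' (m + 1) (by simp; omega)) (committee score σ δ x m)
      have h3 : committee score σ δ x (m + 1) = seeRound (empMean score x (m + 1))
        (ucb σ δ (m + 1)) (committee score σ δ x m) := by simp [committee]
      rw [h3]
      linarith
  have : 0 ≤ 2 * N * e * (committee score σ δ x m).card := by positivity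
  linarith

/-- Regret of a run whose confidence intervals are missed by at most `e`; `B` indicates an invalid
confidence interval among the first `n` rounds. -/
theorem regret_le {p : Fin N → ℝ} (hp : ∀ i, p i ∈ Set.Icc (0 : ℝ) 1)
    (hs : ∀ i y, score i y ∈ Set.Icc (0 : ℝ) 1) {O : Finset (Fin N)} (hO : IsBestTop p O)
    {E : Finset (Fin N)} {n T : ℕ} (hn : 1 ≤ n) {ε : ℝ} (hε : 4 * ucb σ δ n < ε)
    (hgap : ∀ i j, i ≠ j → ε ≤ |p i - p j|) (hb : 2 * ucb σ δ n < consistencyGap p)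
    {B e : ℝ} (hB : 0 ≤ B) (he : 0 ≤ e)
    (hbad : (∃ t ∈ Finset.Icc 1 n, ∃ i, ucb σ δ t < |empMean score x t i - p i|) → 1 ≤ B)
    (h' : ∀ t ∈ Finset.Icc 1 T, ∀ i, |empMean score x t i - p i| ≤ ucb σ δ t + e) :
    regret p E (committee score σ δ x) T ≤ n + T * (B + 2 * N ^ 2 * e) := by
  have hle : ∀ t ∈ Finset.range T, pMaj p E - pMaj p (committee score σ δ x t) ≤
      (if t < n then 1 else 0) + (B + 2 * N ^ 2 * e) := by
    intro t ht
    have h0 : 0 ≤ 2 * (N : ℝ) ^ 2 * e := by positivity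
    have h1 : pMaj p E - pMaj p (committee score σ δ x t) ≤ 1 := by
      linarith [(pMaj_mem_Icc hp E).2, (pMaj_mem_Icc hp (committee score σ δ x t)).1]
    split_ifs with htn
    · linarith
    · by_cases hex : ∃ t ∈ Finset.Icc 1 n, ∃ i, ucb σ δ t < |empMean score x t i - p i|
      · linarith [hbad hex]
      · push Not at hex
        have h2 := pMaj_sub_pMaj_committee_le hp hs hO hn (not_lt.1 htn) hex hε hgap hb he
          fun t' ht' => h' t' (by simp at ht ht' ⊢; omega)
        -- The comparison committee `E` need not equal `O`; only its accuracy enters.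
        linarith [hO.optimal E]
  refine (Finset.sum_le_sum hle).trans ?_
  rw [Finset.sum_add_distrib, Finset.sum_const, Finset.card_range, nsmul_eq_mul, ← Finset.sum_filter,
    Finset.sum_const, nsmul_eq_mul, mul_one]
  gcongr
  refine (Finset.card_le_card (t := Finset.range n) fun t ht => ?_).trans_eq (Finset.card_range n)
  simp at ht ⊢; exact ht.2

end Run

/-! ### A maximal inequality for empirical means -/

/-- The exponential weight at which the Chernoff bound for `t` samples is optimal at the level of
the confidence half-width. -/
def chernoffRate (σ L : ℝ) (t : ℕ) : ℝ := √(2 * t * L) / σ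

theorem chernoffRate_mul_width {σ L : ℝ} (hσ : 0 < σ) (hL : 0 ≤ L) {t : ℕ} (ht : 1 ≤ t) :
    chernoffRate σ L t * √(2 * σ ^ 2 * L / t) = 2 * L := by
  have ht' : (0 : ℝ) < t := by exact_mod_cast ht
  unfold chernoffRate
  rw [div_mul_eq_mul_div, ← Real.sqrt_mul (by positivity)]
  have : 2 * (t : ℝ) * L * (2 * σ ^ 2 * L / t) = (2 * L * σ) ^ 2 := by field_simp
  rw [this, Real.sqrt_sq (by positivity)]
  field_simp

/-- A deviation that changes slowly exceeds the confidence half-width at many neighbouring times,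
hence a weighted sum of exponentials controls its largest excess. -/
theorem sub_width_le_sum_exp {f : ℕ → ℝ} {σ L : ℝ} (hσ : 0 < σ) (hL : 1 ≤ L)
    (hf : ∀ t, f t ≤ 1)
    (hlip : ∀ t s : ℕ, 1 ≤ t → t ≤ s → f t - ((s : ℝ) - t) / s ≤ f s)
    {t T : ℕ} (ht : 1 ≤ t) (htT : t ≤ T) :
    f t - √(2 * σ ^ 2 * L / t) ≤
      6 * ∑ s ∈ Finset.Icc 1 (2 * T), Real.exp (chernoffRate σ L s * f s - 2 * L) / s := by
  set b : ℕ → ℝ := fun s => √(2 * σ ^ 2 * L / s) with hb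
  set e := f t - b t with he
  have hterm : ∀ s : ℕ, 0 ≤ Real.exp (chernoffRate σ L s * f s - 2 * L) / s :=
    fun s => by positivity
  rcases le_or_gt e 0 with h0 | h0
  · exact h0.trans (mul_nonneg (by norm_num) (Finset.sum_nonneg fun s _ => hterm s))
  have ht0 : (0 : ℝ) < t := by exact_mod_cast ht
  have hb1 : b t < 1 := by linarith [hf t]
  have hsmall : 2 * σ ^ 2 * L < t := by
    have := (Real.sqrt_lt' one_pos).1 hb1
    rwa [one_pow, div_lt_one ht0] at this
  -- The window length `t / chernoffRate σ L t`: over so many further samples the drift of `f` costs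
  -- at most `1` in the exponent. The window also stays below `2t`, hence the sum up to `2 * T`.
  set a := σ * √t / √(2 * L) with ha
  have h2L : 0 < √(2 * L) := Real.sqrt_pos.2 (by linarith)
  have ha0 : 0 ≤ a := by positivity
  have hat : a ≤ t := by
    rw [ha, div_le_iff₀ h2L]
    have h1 : σ ^ 2 ≤ t := by nlinarith [sq_nonneg σ]
    have h2 : σ ≤ √t := Real.le_sqrt_of_sq_le h1
    have h3 : (1 : ℝ) ≤ √(2 * L) := Real.one_le_sqrt.2 (by linarith)
    nlinarith [Real.mul_self_sqrt ht0.le, Real.sqrt_nonneg (t : ℝ)]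
  have hrate : chernoffRate σ L t * a = t := by
    have h1 : √(2 * t * L) = √t * √(2 * L) := by
      rw [← Real.sqrt_mul ht0.le]; congr 1; ring
    rw [chernoffRate, h1, ha]
    field_simp
    exact Real.sq_sqrt ht0.le
  have hr0 : 0 < chernoffRate σ L t := by
    unfold chernoffRate; positivity
  set n := ⌊a⌋₊ with hn
  have hna : (n : ℝ) ≤ a := Nat.floor_le ha0
  have hnt : n ≤ t := by exact_mod_cast hna.trans hat
  have hwin : ∀ s ∈ Finset.Icc t (t + n), chernoffRate σ L t * e / (Real.exp 1 * (2 * t)) ≤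
      Real.exp (chernoffRate σ L s * f s - 2 * L) / s := by
    intro s hs
    rw [Finset.mem_Icc] at hs
    have hs1 : 1 ≤ s := ht.trans hs.1
    have hs0 : (0 : ℝ) < s := by exact_mod_cast hs1
    have hts : (t : ℝ) ≤ s := by exact_mod_cast hs.1
    have hst : (s : ℝ) ≤ t + n := by exact_mod_cast hs.2
    have hbs : b s ≤ b t := Real.sqrt_le_sqrt (by gcongr)
    have hrs : chernoffRate σ L t ≤ chernoffRate σ L s := by
      unfold chernoffRate; gcongr
    have hrs' : chernoffRate σ L s * t ≤ chernoffRate σ L t * s := by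
      have h1 : ∀ u : ℕ, chernoffRate σ L u = √u * (√(2 * L) / σ) := by
        intro u
        rw [chernoffRate, mul_div_assoc', ← Real.sqrt_mul u.cast_nonneg]; congr 2; ring
      have h2 : √s * t ≤ √t * s := by
        have e1 := Real.mul_self_sqrt ht0.le
        have e2 := Real.mul_self_sqrt hs0.le
        have e3 : √(t : ℝ) ≤ √s := Real.sqrt_le_sqrt hts
        have e4 := mul_le_mul_of_nonneg_left e3
          (mul_nonneg (Real.sqrt_nonneg (t : ℝ)) (Real.sqrt_nonneg (s : ℝ)))
        linear_combination e4 + √(t : ℝ) * e2 - √(s : ℝ) * e1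
      rw [h1 s, h1 t]
      nlinarith [mul_le_mul_of_nonneg_right h2 (by positivity : 0 ≤ √(2 * L) / σ)]
    have hshift : chernoffRate σ L s * (((s : ℝ) - t) / s) ≤ 1 := by
      rw [mul_div_assoc', div_le_one hs0]
      have h1 : chernoffRate σ L s * ((s : ℝ) - t) ≤ chernoffRate σ L s * a := by
        refine mul_le_mul_of_nonneg_left (by linarith) (hr0.le.trans hrs)
      have h2 : chernoffRate σ L s * a * t ≤ s * t := by
        nlinarith [mul_le_mul_of_nonneg_right hrs' ha0]
      linarith [le_of_mul_le_mul_right h2 ht0]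
    have hexp : chernoffRate σ L t * e - 1 ≤ chernoffRate σ L s * f s - 2 * L := by
      rw [← chernoffRate_mul_width hσ (by linarith) hs1]
      have h1 := hlip t s ht hs.1
      have h2 : chernoffRate σ L s * (e - ((s : ℝ) - t) / s) ≤ chernoffRate σ L s * (f s - b s) :=
        mul_le_mul_of_nonneg_left (by linarith) (hr0.le.trans hrs)
      have h3 := mul_le_mul_of_nonneg_right hrs h0.le
      simp only [hb] at h2
      linarith
    have h4 : chernoffRate σ L t * e / Real.exp 1 ≤
        Real.exp (chernoffRate σ L s * f s - 2 * L) := by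
      refine le_trans ?_ (Real.exp_le_exp.2 hexp)
      rw [Real.exp_sub]
      gcongr
      linarith [Real.add_one_le_exp (chernoffRate σ L t * e)]
    rw [← div_div]
    have hnt' : (n : ℝ) ≤ t := by exact_mod_cast hnt
    gcongr
    linarith
  have hsum : ((n : ℝ) + 1) * (chernoffRate σ L t * e / (Real.exp 1 * (2 * t))) ≤
      ∑ s ∈ Finset.Icc 1 (2 * T), Real.exp (chernoffRate σ L s * f s - 2 * L) / s := by
    calc _ = ∑ s ∈ Finset.Icc t (t + n), chernoffRate σ L t * e / (Real.exp 1 * (2 * t)) := by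
          rw [Finset.sum_const, Nat.card_Icc, nsmul_eq_mul]
          congr 1
          rw [Nat.add_right_comm, Nat.add_assoc, Nat.add_sub_cancel_left]; push_cast; ring
      _ ≤ ∑ s ∈ Finset.Icc t (t + n), Real.exp (chernoffRate σ L s * f s - 2 * L) / s :=
          Finset.sum_le_sum hwin
      _ ≤ _ := Finset.sum_le_sum_of_subset_of_nonneg
          (Finset.Icc_subset_Icc ht (by omega)) fun s _ _ => hterm s
  have hfl : a ≤ n + 1 := (Nat.lt_floor_add_one a).le
  have h5 : a * (chernoffRate σ L t * e / (Real.exp 1 * (2 * t))) = e / (2 * Real.exp 1) := by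
    have : a * (chernoffRate σ L t * e / (Real.exp 1 * (2 * t))) =
        (chernoffRate σ L t * a) * e / (Real.exp 1 * (2 * t)) := by ring
    rw [this, hrate]; field_simp
  have h6 : e / (2 * Real.exp 1) ≤ _ := h5 ▸ (mul_le_mul_of_nonneg_right hfl (by positivity)).trans hsum
  rw [div_le_iff₀ (by positivity)] at h6
  -- The window yields `e / (2 exp 1)`, and `2 exp 1 < 6`.
  have h7 := Real.exp_one_lt_d9
  have h8 := Finset.sum_nonneg fun s (_ : s ∈ Finset.Icc 1 (2 * T)) => hterm s
  nlinarith

/-! ### Drift and sub-Gaussian tails of the empirical competencies -/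

section Run

variable {𝒳 : Type*} {score : Fin N → 𝒳 → ℝ}

/-- The `s - t` new scores carry weight `(s - t)/s` in the new mean, and both they and the old mean
lie in the unit interval. This is the slow change required by the maximal inequality. -/
theorem abs_empMean_sub_empMean_le (hs : ∀ i y, score i y ∈ Set.Icc (0 : ℝ) 1) (x : ℕ → 𝒳)
    (i : Fin N) {t s : ℕ} (ht : 1 ≤ t) (hts : t ≤ s) :
    |empMean score x s i - empMean score x t i| ≤ ((s : ℝ) - t) / s := by
  have ht0 : (0 : ℝ) < t := by exact_mod_cast ht
  have hs0 : (0 : ℝ) < s := by exact_mod_cast ht.trans hts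
  have hts' : (t : ℝ) ≤ s := by exact_mod_cast hts
  obtain ⟨k, rfl⟩ := Nat.exists_eq_add_of_le hts
  have hq := empMean_mem_Icc hs x t i
  have h1 : ∑ u ∈ Finset.range t, score i (x u) = t * empMean score x t i := by
    unfold empMean; field_simp
  set D := ∑ u ∈ Finset.range k, score i (x (t + u)) with hD
  have h2 : 0 ≤ D := Finset.sum_nonneg fun u _ => (hs i _).1
  have h3 : D ≤ k := by
    simpa using Finset.sum_le_sum fun u (_ : u ∈ Finset.range k) => (hs i (x (t + u))).2
  have h4 : empMean score x (t + k) i = (t * empMean score x t i + D) / (t + k : ℕ) := by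
    rw [← h1, hD, ← Finset.sum_range_add]; rfl
  have hk : (0 : ℝ) ≤ k := k.cast_nonneg
  rw [h4]
  push_cast at hs0 ⊢
  have h5 : (t * empMean score x t i + D) / ((t : ℝ) + k) - empMean score x t i =
      (D - k * empMean score x t i) / (t + k) := by field_simp; ring
  rw [h5, abs_div, abs_of_pos hs0, add_sub_cancel_left]
  gcongr
  rw [abs_le]
  constructor <;> nlinarith [hq.1, hq.2]

variable {Ω : Type*} [MeasurableSpace Ω] {μ : Measure Ω}
  [MeasurableSpace 𝒳] {P : Measure 𝒳} {σ : ℝ≥0} {ctx : ℕ → Ω → 𝒳}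

theorem hasSubgaussianMGF_empMean_sub (hmeas : ∀ i, Measurable (score i)) {i : Fin N}
    (hsub : HasSubgaussianMGF (fun y => score i y - competency P score i) (σ ^ 2) P)
    (hctx : ∀ t, Measurable (ctx t)) (hindep : iIndepFun ctx μ) (hlaw : ∀ t, μ.map (ctx t) = P)
    {t : ℕ} (ht : 1 ≤ t) :
    HasSubgaussianMGF
      (fun ω => empMean score (fun s => ctx s ω) t i - competency P score i) (σ ^ 2 / t) μ := by
  have ht0 : (0 : ℝ) < t := by exact_mod_cast ht
  have h1 : ∀ s, HasSubgaussianMGF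
      (fun ω => score i (ctx s ω) - competency P score i) (σ ^ 2) μ := by
    intro s
    have h := hsub
    rw [← hlaw s] at h
    have := h.of_map (hctx s).aemeasurable
    rwa [hlaw s] at this
  have h2 : iIndepFun (fun s ω => score i (ctx s ω) - competency P score i) μ :=
    hindep.comp (fun _ y => score i y - competency P score i)
      fun _ => (hmeas i).sub_const _
  have h3 := HasSubgaussianMGF.sum_of_iIndepFun h2 (s := Finset.range t) fun s _ => h1 s
  have h4 := h3.const_mul (1 / (t : ℝ))
  convert h4 using 1
  · funext ω
    simp only [empMean, Finset.sum_sub_distrib, Finset.sum_const, Finset.card_range, nsmul_eq_mul]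
    field_simp
  · ext
    change ((σ ^ 2 / t : ℝ≥0) : ℝ) =
      (1 / (t : ℝ)) ^ 2 * ((∑ _s ∈ Finset.range t, σ ^ 2 : ℝ≥0) : ℝ)
    simp only [Finset.sum_const, Finset.card_range, nsmul_eq_mul]
    push_cast
    field_simp

/-- The Chernoff bound at the level of the confidence half-width. -/
theorem integral_exp_chernoffRate_le {Y : Ω → ℝ} {t : ℕ} (ht : 1 ≤ t) (hσ : 0 < σ) {L : ℝ}
    (hL : 0 ≤ L) (hY : HasSubgaussianMGF Y (σ ^ 2 / t) μ) :
    Integrable (fun ω => Real.exp (chernoffRate σ L t * Y ω - 2 * L)) μ ∧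
      ∫ ω, Real.exp (chernoffRate σ L t * Y ω - 2 * L) ∂μ ≤ Real.exp (-L) := by
  have ht0 : (0 : ℝ) < t := by exact_mod_cast ht
  have hσ' : (0 : ℝ) < σ := hσ
  simp only [Real.exp_sub]
  refine ⟨(hY.integrable_exp_mul _).div_const _, ?_⟩
  rw [integral_div, div_le_iff₀ (Real.exp_pos _), ← Real.exp_add]
  refine (hY.mgf_le _).trans (Real.exp_le_exp.2 (le_of_eq ?_))
  push_cast
  unfold chernoffRate
  -- At this rate the sub-Gaussian exponent equals `L`, and `L - 2L = -L`.
  rw [div_pow, Real.sq_sqrt (by positivity)]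
  field_simp
  ring

end Run

/-! ### Number of experts, locality in the samples, and a harmonic sum -/

/-- Separated points fall into different cells of length `m`, and the unit interval meets at most
`1/m + 1` of them. -/
theorem card_le_of_separated {p : Fin N → ℝ} (hp : ∀ i, p i ∈ Set.Icc (0 : ℝ) 1) {m : ℝ}
    (hm : 0 < m) (hm1 : m ≤ 1) (hsep : ∀ i j, i ≠ j → m ≤ |p i - p j|) : (N : ℝ) * m ≤ 2 := by
  have hmaps : ∀ i ∈ (Finset.univ : Finset (Fin N)),
      ⌊p i / m⌋₊ ∈ Finset.range (⌊1 / m⌋₊ + 1) := by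
    intro i _
    rw [Finset.mem_range, Nat.lt_succ_iff]
    exact Nat.floor_le_floor (div_le_div_of_nonneg_right (hp i).2 hm.le)
  have hinj : Set.InjOn (fun i => ⌊p i / m⌋₊) (Finset.univ : Finset (Fin N)) := by
    intro i _ j _ hij
    by_contra hne
    have h1 := Nat.floor_le (div_nonneg (hp i).1 hm.le)
    have h2 := Nat.lt_floor_add_one (p i / m)
    have h3 := Nat.floor_le (div_nonneg (hp j).1 hm.le)
    have h4 := Nat.lt_floor_add_one (p j / m)
    simp only at hij
    rw [hij] at h1 h2
    have h5 : |p i / m - p j / m| < 1 := abs_lt.2 ⟨by linarith, by linarith⟩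
    rw [← sub_div, abs_div, abs_of_pos hm, div_lt_one hm] at h5
    exact (hsep i j hne).not_gt h5
  have hcard := Finset.card_le_card_of_injOn _ hmaps hinj
  rw [Finset.card_univ, Fintype.card_fin, Finset.card_range] at hcard
  have h1 : (N : ℝ) ≤ ⌊1 / m⌋₊ + 1 := by exact_mod_cast hcard
  have h2 : (⌊1 / m⌋₊ : ℝ) ≤ 1 / m := Nat.floor_le (by positivity)
  calc (N : ℝ) * m ≤ (1 / m + 1) * m := by gcongr; linarith
    _ = 1 + m := by field_simp
    _ ≤ 2 := by linarith

theorem committee_congr {𝒳 𝒴 : Type*} {score : Fin N → 𝒳 → ℝ} {score' : Fin N → 𝒴 → ℝ} (σ δ : ℝ)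
    {x : ℕ → 𝒳} {y : ℕ → 𝒴} {n : ℕ} (h : ∀ i, ∀ s < n, score i (x s) = score' i (y s)) :
    committee score σ δ x n = committee score' σ δ y n := by
  induction n with
  | zero => rfl
  | succ n ih =>
    have hq : empMean score x (n + 1) = empMean score' y (n + 1) := by
      funext i
      unfold empMean
      rw [Finset.sum_congr rfl fun s hs => h i s (Finset.mem_range.1 hs)]
    rw [committee, committee, ih fun i s hs => h i s (by omega), hq]

theorem sum_Icc_one_div_le {n : ℕ} :
    ∑ s ∈ Finset.Icc 1 n, (1 : ℝ) / s ≤ 1 + Real.log n := by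
  have h := harmonic_le_one_add_log n
  rw [harmonic_eq_sum_Icc] at h
  push_cast at h
  simpa using h

/-! ### Exponential weights that control violated confidence intervals -/

section Weight

variable {𝒳 : Type*} {score : Fin N → 𝒳 → ℝ}

/-- Two-sided exponential weight of the deviation of the empirical competency. -/
def deviationWeight (score : Fin N → 𝒳 → ℝ) (p : Fin N → ℝ) (σ L : ℝ) (x : ℕ → 𝒳) (i : Fin N)
    (t : ℕ) : ℝ :=
  Real.exp (chernoffRate σ L t * (empMean score x t i - p i) - 2 * L) +
    Real.exp (chernoffRate σ L t * -(empMean score x t i - p i) - 2 * L)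

theorem deviationWeight_nonneg {σ L : ℝ} {p : Fin N → ℝ} (x : ℕ → 𝒳) (i : Fin N) (t : ℕ) :
    0 ≤ deviationWeight score p σ L x i t := by
  unfold deviationWeight; positivity

theorem one_le_deviationWeight {σ L : ℝ} (hσ : 0 < σ) (hL : 0 ≤ L) {p : Fin N → ℝ} {x : ℕ → 𝒳}
    {i : Fin N} {t : ℕ} (ht : 1 ≤ t)
    (h : √(2 * σ ^ 2 * L / t) < |empMean score x t i - p i|) :
    1 ≤ deviationWeight score p σ L x i t := by
  have hr : 0 ≤ chernoffRate σ L t := by unfold chernoffRate; positivity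
  have hw := chernoffRate_mul_width hσ hL ht
  have key : ∀ u, √(2 * σ ^ 2 * L / t) < u → 1 ≤ Real.exp (chernoffRate σ L t * u - 2 * L) := by
    intro u hu
    refine Real.one_le_exp ?_
    nlinarith [mul_le_mul_of_nonneg_left hu.le hr]
  unfold deviationWeight
  rcases lt_abs.1 h with h | h
  · linarith [key _ h, Real.exp_pos (chernoffRate σ L t * -(empMean score x t i - p i) - 2 * L)]
  · linarith [key _ h, Real.exp_pos (chernoffRate σ L t * (empMean score x t i - p i) - 2 * L)]

theorem abs_sub_le_width_add_sum_deviationWeight (hs : ∀ i y, score i y ∈ Set.Icc (0 : ℝ) 1)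
    {p : Fin N → ℝ} (hp : ∀ i, p i ∈ Set.Icc (0 : ℝ) 1) {σ L : ℝ} (hσ : 0 < σ) (hL : 1 ≤ L)
    (x : ℕ → 𝒳) (i : Fin N) {t T : ℕ} (ht : 1 ≤ t) (htT : t ≤ T) :
    |empMean score x t i - p i| ≤ √(2 * σ ^ 2 * L / t) +
      6 * ∑ s ∈ Finset.Icc 1 (2 * T), deviationWeight score p σ L x i s / s := by
  have hq := empMean_mem_Icc hs x
  have hlip : ∀ t s : ℕ, 1 ≤ t → t ≤ s →
    |empMean score x s i - empMean score x t i| ≤ ((s : ℝ) - t) / s := fun t s h1 h2 =>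
      abs_empMean_sub_empMean_le hs x i h1 h2
  have h1 := sub_width_le_sum_exp (f := fun t => empMean score x t i - p i) hσ hL
    (fun t => by linarith [(hq t i).2, (hp i).1])
    (fun t s h1 h2 => by linarith [(abs_le.1 (hlip t s h1 h2)).1]) ht htT
  have h2 := sub_width_le_sum_exp (f := fun t => -(empMean score x t i - p i)) hσ hL
    (fun t => by linarith [(hq t i).1, (hp i).2])
    (fun t s h1 h2 => by linarith [(abs_le.1 (hlip t s h1 h2)).2]) ht htT
  simp only [deviationWeight, add_div, Finset.sum_add_distrib]
  have h3 := Finset.sum_nonneg fun s (_ : s ∈ Finset.Icc 1 (2 * T)) =>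
    (by positivity : 0 ≤ Real.exp (chernoffRate σ L s * (empMean score x s i - p i) - 2 * L) / s)
  have h4 := Finset.sum_nonneg fun s (_ : s ∈ Finset.Icc 1 (2 * T)) =>
    (by positivity : 0 ≤ Real.exp (chernoffRate σ L s * -(empMean score x s i - p i) - 2 * L) / s)
  exact abs_le.2 ⟨by linarith, by linarith⟩

end Weight

/-! ### Integrability and expected regret -/

section Expectation

variable {𝒳 : Type*} [MeasurableSpace 𝒳] {score : Fin N → 𝒳 → ℝ}
  {Ω : Type*} [MeasurableSpace Ω] {μ : Measure Ω} {P : Measure 𝒳} {σ : ℝ≥0} {ctx : ℕ → Ω → 𝒳}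

theorem integral_deviationWeight_le (hmeas : ∀ i, Measurable (score i)) {i : Fin N}
    (hsub : HasSubgaussianMGF (fun y => score i y - competency P score i) (σ ^ 2) P)
    (hctx : ∀ t, Measurable (ctx t)) (hindep : iIndepFun ctx μ) (hlaw : ∀ t, μ.map (ctx t) = P)
    (hσ : 0 < σ) {L : ℝ} (hL : 0 ≤ L) {t : ℕ} (ht : 1 ≤ t) :
    Integrable
      (fun ω => deviationWeight score (competency P score) σ L (fun s => ctx s ω) i t) μ ∧
    ∫ ω, deviationWeight score (competency P score) σ L (fun s => ctx s ω) i t ∂μ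
      ≤ 2 * Real.exp (-L) := by
  have hY := hasSubgaussianMGF_empMean_sub hmeas hsub hctx hindep hlaw ht
  obtain ⟨h1, h2⟩ := integral_exp_chernoffRate_le ht hσ hL hY
  obtain ⟨h3, h4⟩ := integral_exp_chernoffRate_le ht hσ hL hY.neg
  simp only [Pi.neg_apply] at h3 h4
  unfold deviationWeight
  refine ⟨h1.add h3, ?_⟩
  rw [integral_add h1 h3]
  linarith

variable [IsProbabilityMeasure μ] [IsProbabilityMeasure P]

/-- The regret is bounded and factors through the finite table of the binary scores of the first `T`
contexts; every function on that discrete space is measurable, so the algorithm itself needs no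
measurability analysis. -/
theorem integrable_regret {p : Fin N → ℝ} (hp : ∀ i, p i ∈ Set.Icc (0 : ℝ) 1)
    (hmeas : ∀ i, Measurable (score i)) (hbin : ∀ i y, score i y = 0 ∨ score i y = 1)
    (hctx : ∀ t, Measurable (ctx t)) (E : Finset (Fin N)) (σ δ : ℝ) (T : ℕ) :
    Integrable (fun ω => regret p E (committee score σ δ (fun t => ctx t ω)) T) μ := by
  classical
  set g : Ω → Fin T → Fin N → Bool := fun ω t i => decide (score i (ctx t ω) = 1) with hg
  have hgm : Measurable g := by
    refine measurable_pi_lambda _ fun t => measurable_pi_lambda _ fun i => ?_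
    refine measurable_to_bool ?_
    have : (fun ω => g ω t i) ⁻¹' {true} = (fun ω => score i (ctx t ω)) ⁻¹' {1} := by
      ext ω; simp [hg]
    exact this ▸ ((hmeas i).comp (hctx t)) (measurableSet_singleton 1)
  set score' : Fin N → (Fin N → Bool) → ℝ := fun i y => if y i then 1 else 0
  set F : (Fin T → Fin N → Bool) → ℝ := fun y =>
    regret p E (committee score' σ δ (fun t => if h : t < T then y ⟨t, h⟩ else fun _ => false)) T
  have hF : (fun ω => regret p E (committee score σ δ (fun t => ctx t ω)) T) = F ∘ g := by
    funext ω
    refine Finset.sum_congr rfl fun t ht => ?_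
    rw [committee_congr (score' := score')]
    intro i s hs
    rw [dif_pos (hs.trans (Finset.mem_range.1 ht))]
    rcases hbin i (ctx s ω) with h | h <;> simp [score', hg, h]
  refine Integrable.of_bound (C := T) ?_ (Filter.Eventually.of_forall fun ω => ?_)
  · rw [hF]
    exact ((Measurable.of_discrete (f := F)).comp hgm).aestronglyMeasurable
  · rw [Real.norm_eq_abs]
    refine (Finset.abs_sum_le_sum_abs _ _).trans ?_
    have h : ∀ t ∈ Finset.range T,
        |pMaj p E - pMaj p (committee score σ δ (fun t => ctx t ω) t)| ≤ 1 := by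
      intro t _
      have h1 := pMaj_mem_Icc hp E
      have h2 := pMaj_mem_Icc hp (committee score σ δ (fun t => ctx t ω) t)
      exact abs_le.2 ⟨by linarith [h1.1, h2.2], by linarith [h1.2, h2.1]⟩
    simpa using Finset.sum_le_sum h

theorem competency_mem_Icc (hmeas : ∀ i, Measurable (score i))
    (hs : ∀ i y, score i y ∈ Set.Icc (0 : ℝ) 1) (i : Fin N) :
    competency P score i ∈ Set.Icc (0 : ℝ) 1 := by
  have hint : Integrable (score i) P := Integrable.of_bound (C := 1)
    (hmeas i).aestronglyMeasurable (Filter.Eventually.of_forall fun y => by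
      rw [Real.norm_eq_abs, abs_of_nonneg (hs i y).1]; exact (hs i y).2)
  unfold competency
  refine ⟨integral_nonneg fun y => (hs i y).1, ?_⟩
  simpa using integral_mono hint (integrable_const (1 : ℝ)) fun y => (hs i y).2

/-- Expected regret in terms of a round `n` at which the confidence intervals are short. -/
theorem integral_regret_le (hmeas : ∀ i, Measurable (score i))
    (hbin : ∀ i y, score i y = 0 ∨ score i y = 1)
    (hsub : ∀ i, HasSubgaussianMGF (fun y => score i y - competency P score i) (σ ^ 2) P)
    (hctx : ∀ t, Measurable (ctx t)) (hindep : iIndepFun ctx μ) (hlaw : ∀ t, μ.map (ctx t) = P)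
    {O : Finset (Fin N)} (hO : IsBestTop (competency P score) O) (E : Finset (Fin N))
    {n T : ℕ} (hn : 1 ≤ n) (hT : 1 ≤ T) {ε : ℝ} (hε : 4 * ucb σ (1 / T) n < ε)
    (hgap : ∀ i j, i ≠ j → ε ≤ |competency P score i - competency P score j|)
    (hb : 2 * ucb σ (1 / T) n < consistencyGap (competency P score)) :
    ∫ ω, regret (competency P score) E (committee score σ (1 / T) (fun t => ctx t ω)) T ∂μ ≤
      n + n * N + 6 * N ^ 3 * (1 + Real.log (2 * T)) := by
  set p := competency P score with hpdef
  have hs : ∀ i y, score i y ∈ Set.Icc (0 : ℝ) 1 := fun i y => by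
    rcases hbin i y with h | h <;> simp [h]
  have hp : ∀ i, p i ∈ Set.Icc (0 : ℝ) 1 := competency_mem_Icc hmeas hs
  have hint := integrable_regret (μ := μ) hp hmeas hbin hctx E σ (1 / T) T
  have hT0 : (1 : ℝ) ≤ T := by exact_mod_cast hT
  have hlog : 0 ≤ Real.log (2 * T) := Real.log_nonneg (by linarith)
  -- The Chernoff rate divides by `σ`. For `σ = 0` the deviations vanish almost surely, and the
  -- pathwise bound applies with zero error terms.
  rcases eq_or_lt_of_le (zero_le (a := σ)) with hσ | hσ
  · have hae : ∀ᵐ ω ∂μ, ∀ t : ℕ, ∀ i, 1 ≤ t → empMean score (fun s => ctx s ω) t i - p i = 0 := by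
      rw [ae_all_iff]; intro t
      rw [ae_all_iff]; intro i
      by_cases ht : 1 ≤ t
      · have := hasSubgaussianMGF_empMean_sub hmeas (hsub i) hctx hindep hlaw ht
        rw [← hσ] at this
        simp only [ne_eq, OfNat.ofNat_ne_zero, not_false_eq_true, zero_pow, zero_div] at this
        filter_upwards [this.ae_eq_zero_of_hasSubgaussianMGF_zero] with ω hω _
        exact hω
      · exact Filter.Eventually.of_forall fun ω h => absurd h ht
    have hle : ∀ᵐ ω ∂μ, regret p E (committee score σ (1 / T) (fun t => ctx t ω)) T ≤ (n : ℝ) := by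
      filter_upwards [hae] with ω hω
      have := regret_le (x := fun t => ctx t ω) (E := E) (T := T) hp hs hO hn hε hgap hb
        (B := 0) (e := 0) le_rfl le_rfl ?_ ?_
      · simpa using this
      · rintro ⟨t, ht, i, hi⟩
        rw [hω t i (Finset.mem_Icc.1 ht).1, abs_zero] at hi
        exact absurd hi (ucb_nonneg _ _ _).not_gt
      · intro t ht i
        rw [hω t i (Finset.mem_Icc.1 ht).1, abs_zero, add_zero]
        exact ucb_nonneg _ _ _
    have h1 := integral_mono_ae hint (integrable_const (n : ℝ)) hle
    simp only [integral_const, probReal_univ, one_smul] at h1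
    refine h1.trans ?_
    have : 0 ≤ (n : ℝ) * N + 6 * N ^ 3 * (1 + Real.log (2 * T)) := by positivity
    linarith
  set L := Real.log (4 / (1 / (T : ℝ))) with hLdef
  have hTL : Real.exp (-L) = 1 / (4 * T) := by
    rw [hLdef, Real.exp_neg, Real.exp_log (by positivity)]; field_simp
  have hL : 1 ≤ L := by
    rw [hLdef, Real.le_log_iff_exp_le (by positivity)]
    have : 4 / (1 / (T : ℝ)) = 4 * T := by field_simp
    rw [this]
    linarith [Real.exp_one_lt_d9]
  have hσ' : (0 : ℝ) < σ := hσ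
  set W : Ω → Fin N → ℕ → ℝ := fun ω => deviationWeight score p σ L (fun s => ctx s ω) with hW
  have hW0 : ∀ ω i t, 0 ≤ W ω i t := fun ω i t => deviationWeight_nonneg _ _ _
  have hWint : ∀ i t, 1 ≤ t → Integrable (fun ω => W ω i t) μ ∧
      ∫ ω, W ω i t ∂μ ≤ 1 / (2 * T) := by
    intro i t ht
    obtain ⟨h1, h2⟩ := integral_deviationWeight_le hmeas (hsub i) hctx hindep hlaw hσ
      (by linarith : 0 ≤ L) ht
    refine ⟨h1, h2.trans_eq ?_⟩
    rw [hTL]; field_simp; norm_num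
  -- Markov-type majorants: any violation up to round `n` makes one summand of `B` at least `1`,
  -- while `e` dominates every excess up to round `T`. In `e` the weights `1/s` turn a sum over
  -- rounds into a logarithm.
  set B : Ω → ℝ := fun ω => ∑ t ∈ Finset.Icc 1 n, ∑ i, W ω i t with hB
  set e : Ω → ℝ := fun ω => ∑ i, 6 * ∑ s ∈ Finset.Icc 1 (2 * T), W ω i s / s with he
  have hpath : ∀ ω, regret p E (committee score σ (1 / T) (fun t => ctx t ω)) T ≤
      n + T * (B ω + 2 * N ^ 2 * e ω) := by
    intro ω
    have hterm : ∀ i, 0 ≤ 6 * ∑ s ∈ Finset.Icc 1 (2 * T), W ω i s / s := fun i =>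
      mul_nonneg (by norm_num) (Finset.sum_nonneg fun s _ => div_nonneg (hW0 _ _ _) s.cast_nonneg)
    refine regret_le hp hs hO hn hε hgap hb
      (Finset.sum_nonneg fun t _ => Finset.sum_nonneg fun i _ => hW0 _ _ _)
      (Finset.sum_nonneg fun i _ => hterm i) ?_ ?_
    · rintro ⟨t, ht, i, hi⟩
      calc (1 : ℝ) ≤ W ω i t :=
            one_le_deviationWeight hσ' (by linarith) (Finset.mem_Icc.1 ht).1 hi
        _ ≤ ∑ i, W ω i t :=
            Finset.single_le_sum (f := fun i => W ω i t) (fun i _ => hW0 ω i t) (Finset.mem_univ i)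
        _ ≤ B ω := Finset.single_le_sum (f := fun t => ∑ i, W ω i t)
            (fun t _ => Finset.sum_nonneg fun i _ => hW0 ω i t) ht
    · intro t ht i
      rw [Finset.mem_Icc] at ht
      refine (abs_sub_le_width_add_sum_deviationWeight hs hp hσ' hL (fun t => ctx t ω) i
        ht.1 ht.2).trans (add_le_add_right ?_ _)
      exact Finset.single_le_sum
        (f := fun i => 6 * ∑ s ∈ Finset.Icc 1 (2 * T), W ω i s / s) (fun i _ => hterm i)
        (Finset.mem_univ i)
  have hBint : Integrable B μ := integrable_finsetSum _ fun t ht =>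
    integrable_finsetSum _ fun i _ => (hWint i t (Finset.mem_Icc.1 ht).1).1
  have heint' : ∀ i, Integrable (fun ω => ∑ s ∈ Finset.Icc 1 (2 * T), W ω i s / s) μ := fun i =>
    integrable_finsetSum _ fun s hs => (hWint i s (Finset.mem_Icc.1 hs).1).1.div_const _
  have heint : Integrable e μ := integrable_finsetSum _ fun i _ => (heint' i).const_mul 6
  have hBle : ∫ ω, B ω ∂μ ≤ n * (N * (1 / (2 * T))) := by
    rw [integral_finsetSum _ fun t ht =>
      integrable_finsetSum _ fun i _ => (hWint i t (Finset.mem_Icc.1 ht).1).1]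
    have : ∀ t ∈ Finset.Icc 1 n, ∫ ω, ∑ i, W ω i t ∂μ ≤ N * (1 / (2 * T)) := by
      intro t ht
      have ht := (Finset.mem_Icc.1 ht).1
      rw [integral_finsetSum _ fun i _ => (hWint i t ht).1]
      simpa using Finset.sum_le_sum fun i (_ : i ∈ Finset.univ) => (hWint i t ht).2
    simpa using Finset.sum_le_sum this
  have hele : ∫ ω, e ω ∂μ ≤ N * (6 * (1 / (2 * T) * (1 + Real.log (2 * T)))) := by
    rw [integral_finsetSum _ fun i _ => (heint' i).const_mul 6]
    have : ∀ i ∈ Finset.univ, ∫ ω, 6 * ∑ s ∈ Finset.Icc 1 (2 * T), W ω i s / s ∂μ ≤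
        6 * (1 / (2 * T) * (1 + Real.log (2 * T))) := by
      intro i _
      rw [integral_const_mul, integral_finsetSum _ fun s hs =>
        (hWint i s (Finset.mem_Icc.1 hs).1).1.div_const _]
      gcongr
      have h1 : ∀ s ∈ Finset.Icc 1 (2 * T), ∫ ω, W ω i s / s ∂μ ≤ 1 / (2 * T) * (1 / s) := by
        intro s hs
        rw [integral_div, ← div_eq_mul_one_div]
        exact div_le_div_of_nonneg_right (hWint i s (Finset.mem_Icc.1 hs).1).2 s.cast_nonneg
      refine (Finset.sum_le_sum h1).trans ?_
      rw [← Finset.mul_sum]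
      have := sum_Icc_one_div_le (n := 2 * T)
      push_cast at this
      gcongr
    simpa using Finset.sum_le_sum this
  have hmain := integral_mono hint
    ((integrable_const (n : ℝ)).add ((hBint.add (heint.const_mul (2 * (N : ℝ) ^ 2))).const_mul T))
    hpath
  rw [integral_add' (integrable_const _)
      ((hBint.add (heint.const_mul (2 * (N : ℝ) ^ 2))).const_mul (T : ℝ))] at hmain
  simp only [Pi.add_apply] at hmain
  rw [integral_const_mul, integral_add hBint (heint.const_mul _), integral_const_mul,
    integral_const, probReal_univ, one_smul] at hmain
  refine hmain.trans ?_
  calc (n : ℝ) + T * (∫ ω, B ω ∂μ + 2 * N ^ 2 * ∫ ω, e ω ∂μ)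
      ≤ n + T * (n * (N * (1 / (2 * T))) +
          2 * N ^ 2 * (N * (6 * (1 / (2 * T) * (1 + Real.log (2 * T)))))) := by gcongr
    _ = n + n * N / 2 + 6 * N ^ 3 * (1 + Real.log (2 * T)) := by field_simp; ring
    _ ≤ _ := by
      have : 0 ≤ (n : ℝ) * N := by positivity
      linarith

end Expectation

end SEE

end

/-! ### Choice of the round `n` and of the constant -/

theorem theorem1 :
    ∃ K : ℝ, 0 < K ∧
      ∀ (N T : ℕ), 2 ≤ T →
      -- contexts, binary scores, and their sub-Gaussian variance proxy
      ∀ (𝒳 : Type*) [MeasurableSpace 𝒳] (P : Measure 𝒳) [IsProbabilityMeasure P]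
        (score : Fin N → 𝒳 → ℝ),
        (∀ i, Measurable (score i)) →
        (∀ i x, score i x = 0 ∨ score i x = 1) →
      ∀ (σ : ℝ≥0),
        (∀ i, HasSubgaussianMGF (fun x => score i x - SEE.competency P score i) (σ ^ 2) P) →
      -- incrementality, and a positive consistency gap
      ∀ (ε : ℝ), 0 < ε →
        (∀ i j, i ≠ j → ε ≤ |SEE.competency P score i - SEE.competency P score j|) →
        0 < SEE.consistencyGap (SEE.competency P score) →
      -- an optimal egalitarian committee
      ∀ (E : Finset (Fin N)), SEE.IsOptimalCommittee (SEE.competency P score) E →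
      -- an i.i.d. sequence of contexts with law `P`
      ∀ (Ω : Type*) [MeasurableSpace Ω] (μ : Measure Ω) [IsProbabilityMeasure μ]
        (ctx : ℕ → Ω → 𝒳),
        (∀ t, Measurable (ctx t)) → iIndepFun ctx μ → (∀ t, μ.map (ctx t) = P) →
      Integrable (fun ω => SEE.regret (SEE.competency P score) E
          (SEE.committee score σ (1 / (T : ℝ)) (fun t => ctx t ω)) T) μ ∧
      ∫ ω, SEE.regret (SEE.competency P score) E
          (SEE.committee score σ (1 / (T : ℝ)) (fun t => ctx t ω)) T ∂μ
        ≤ K * N * (σ ^ 2 + 1) * Real.log T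
            / (min ε (SEE.consistencyGap (SEE.competency P score))) ^ 2 := by
  -- The estimates below add up to `192` for the `σ²` term and `4 + 96` for the constant term.
  refine ⟨300, by norm_num, ?_⟩
  intro N T hT 𝒳 _ P _ score hmeas hbin σ hsub ε hε hsep hgap E hE Ω _ μ _ ctx hctx hindep hlaw
  set p := SEE.competency P score with hpdef
  have hs : ∀ i y, score i y ∈ Set.Icc (0 : ℝ) 1 := fun i y => by
    rcases hbin i y with h | h <;> simp [h]
  have hp : ∀ i, p i ∈ Set.Icc (0 : ℝ) 1 := SEE.competency_mem_Icc hmeas hs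
  refine ⟨SEE.integrable_regret hp hmeas hbin hctx E σ (1 / (T : ℝ)) T, ?_⟩
  rcases N.eq_zero_or_pos with rfl | hN
  · have h0 : ∀ C : Finset (Fin 0), C = ∅ := fun C => Finset.eq_empty_of_isEmpty C
    have : ∀ C, SEE.regret p E C T = 0 := fun C =>
      Finset.sum_eq_zero fun t _ => by rw [h0 (C t), h0 E, sub_self]
    simp [this]
  set m := min ε (SEE.consistencyGap p) with hm
  have hm0 : 0 < m := lt_min hε hgap
  have hm1 : m ≤ 1 := (min_le_right _ _).trans (SEE.isGreatest_consistencyGap p).1.1.2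
  have hinj : Function.Injective p := by
    intro i j hij
    by_contra hne
    have := hsep i j hne
    rw [hij, sub_self, abs_zero] at this
    linarith
  obtain ⟨O, hO⟩ := SEE.exists_isBestTop hN hp hinj
  have hNm := SEE.card_le_of_separated hp hm0 hm1
    fun i j hij => (min_le_left _ _).trans (hsep i j hij)
  set L := Real.log (4 / (1 / (T : ℝ))) with hL
  set l := Real.log T with hl
  have hT2 : (2 : ℝ) ≤ T := by exact_mod_cast hT
  have hlog2 : Real.log 2 ≤ l := Real.log_le_log (by norm_num) hT2
  have hlog2' := Real.log_two_gt_d9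
  have hL2 : L = 2 * Real.log 2 + l := by
    have e1 : 4 / (1 / (T : ℝ)) = 2 ^ 2 * T := by field_simp; norm_num
    rw [hL, e1, Real.log_mul (by norm_num) (by positivity), Real.log_pow]
    push_cast; rfl
  have hL0 : 0 ≤ L := by linarith
  have h2T : Real.log (2 * T) = Real.log 2 + l := Real.log_mul (by norm_num) (by positivity)
  -- Solving `√(2σ²L/n) < m/4` for `n`. The quarter is dictated by the breakage condition `4b < ε`;
  -- the consistency condition `2b < gap` then holds as well.
  set n := ⌊32 * (σ : ℝ) ^ 2 * L / m ^ 2⌋₊ + 1 with hn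
  have hn_le : (n : ℝ) ≤ 32 * (σ : ℝ) ^ 2 * L / m ^ 2 + 1 := by
    rw [hn]; push_cast
    have := Nat.floor_le (by positivity : 0 ≤ 32 * (σ : ℝ) ^ 2 * L / m ^ 2)
    linarith
  have hn_gt : 32 * (σ : ℝ) ^ 2 * L / m ^ 2 < n := by
    rw [hn]; push_cast
    exact Nat.lt_floor_add_one _
  have hn0 : (0 : ℝ) < n := by rw [hn]; positivity
  have hucb : SEE.ucb σ (1 / T) n < m / 4 := by
    unfold SEE.ucb
    rw [← hL, Real.sqrt_lt' (by linarith), div_lt_iff₀ hn0]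
    rw [div_lt_iff₀ (by positivity)] at hn_gt
    linarith
  have hmain := SEE.integral_regret_le (μ := μ) hmeas hbin hsub hctx hindep hlaw hO E (n := n)
    (T := T) (by omega) (by omega) (ε := m) (by linarith)
    (fun i j hij => (min_le_left _ _).trans (hsep i j hij))
    (by have := min_le_right ε (SEE.consistencyGap p); linarith)
  refine hmain.trans ?_
  rw [le_div_iff₀ (by positivity)]
  have hN1 : (1 : ℝ) ≤ N := by exact_mod_cast hN
  have hmsq : m ^ 2 ≤ 1 := pow_le_one₀ hm0.le hm1
  have hnm : (n : ℝ) * m ^ 2 ≤ (96 * σ ^ 2 + 2) * l := by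
    have h1 := mul_le_mul_of_nonneg_right hn_le (sq_nonneg m)
    rw [add_mul, div_mul_cancel₀ _ (by positivity), one_mul] at h1
    have h2 : 32 * (σ : ℝ) ^ 2 * L ≤ 32 * σ ^ 2 * (3 * l) := by gcongr; linarith
    linarith
  have hNm2 : ((N : ℝ) * m) ^ 2 ≤ 4 := by
    have := pow_le_pow_left₀ (by positivity) hNm 2
    linarith
  have h1 : ((n : ℝ) + n * N) * m ^ 2 ≤ 2 * N * ((96 * σ ^ 2 + 2) * l) := by
    have h2 : (n : ℝ) + n * N ≤ 2 * N * n := by nlinarith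
    calc ((n : ℝ) + n * N) * m ^ 2 ≤ 2 * N * n * m ^ 2 := by gcongr
      _ = 2 * N * (n * m ^ 2) := by ring
      _ ≤ _ := by gcongr
  -- Two of the three factors `N` are traded for `1/m²` through `(Nm)² ≤ 4`.
  have h2 : 6 * (N : ℝ) ^ 3 * (1 + Real.log (2 * T)) * m ^ 2 ≤ 6 * N * 4 * (4 * l) := by
    calc 6 * (N : ℝ) ^ 3 * (1 + Real.log (2 * T)) * m ^ 2
        = 6 * N * (N * m) ^ 2 * (1 + Real.log (2 * T)) := by ring
      _ ≤ _ := by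
        gcongr
        · have : 0 ≤ Real.log (2 * T) := by linarith
          positivity
        · linarith
  have h3 : 0 ≤ (N : ℝ) * σ ^ 2 * l := by
    have : 0 ≤ l := by linarith
    positivity
  have h4 : 0 ≤ (N : ℝ) * l := mul_nonneg (by linarith) (by linarith)
  rw [add_mul]
  linarith
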